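/- Let $X$ be an infinite compact metric space, $\phi : X \to X$ a minimal homeomorphism (every orbit $\{\phi^n(x) : n \in \mathbb Z\}$ is dense), $F : X \to \mathbb R$ a continuous function and $\beta \in \mathbb R \setminus \{0\}$. Let $C(X) \rtimes_\phi \mathbb Z$ be the crossed product, i.e. the universal $C^*$-algebra generated by a copy of $C(X)$ and a unitary $U$ with $U f U^* = f \circ \phi^{-1}$ for $f \in C(X)$; let $E : C(X) \rtimes_\phi \mathbb Z \to C(X)$ be the canonical conditional expectation, with $E(f) = f$ and $E(f U^n) = 0$ for $f \in C(X)$, $n \neq 0$; and let $\alpha^F = \{\alpha^F_t\}_{t \in \mathbb R}$ be the flow on $C(X) \rtimes_\phi \mathbb Z$ determined by $\alpha^F_t(fU) = f U e^{-itF}$ for $f \in C(X)$. A state $\omega$ on $C(X) \rtimes_\phi \mathbb Z$ is a $\beta$-KMS state for $\alpha^F$ when $\omega(ab) = \omega(b\,\alpha^F_{i\beta}(a))$ for all $a, b$ in a dense $\alpha^F$-invariant $*$-algebra of $\alpha^F$-analytic elements. An $e^{\beta F}$-conformal measure is a Borel probability measure $m$ on $X$ with $m(\phi(B)) = \int_B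 e^{\beta F} \, \mathrm{d}m$ for all Borel sets $B \subseteq X$. Then the set of $\beta$-KMS states for $\alpha^F$ is convex, and for every $\beta$-KMS state $\omega$ there is a unique $e^{\beta F}$-conformal measure $m_\omega$ with $\omega(f) = \int_X f \, \mathrm{d}m_\omega$ for all $f \in C(X)$. The map $\omega \mapsto m_\omega$ is an affine homeomorphism from the set of $\beta$-KMS states for $\alpha^F$ (with the weak$^*$ topology) onto the set of $e^{\beta F}$-conformal measures (with the topology of weak convergence), and its inverse sends $m$ to the state $a \mapsto \int_X E(a) \, \mathrm{d}m$. -/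

import Mathlib

open MeasureTheory
open scoped ENNReal ComplexOrder

universe u w

noncomputable section

namespace KMSCrossed

/-- The bounded product of a family of nonzero unital C⋆-algebras is a unital C⋆-algebra. -/
instance boundedProductCStarAlgebra {I : Type*} {A : I → Type*} [∀ i, CStarAlgebra (A i)]
    [∀ i, Nontrivial (A i)] : CStarAlgebra (lp A ∞) where

section CrossedProduct

variable {X : Type u} [TopologicalSpace X] [CompactSpace X]

/-- A covariant pair `(π, V)` in a nonzero unital C⋆-algebra `B` of the universe of `X`: a unital
`⋆`-homomorphism `π : C(X) → B` and a unitary `V ∈ B` with `V π(f) V⋆ = π(f ∘ φ⁻¹)`. -/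
structure CovariantRep (φ : X ≃ₜ X) : Type (u + 1) where
  B : Type u
  [cstar : CStarAlgebra B]
  [nontriv : Nontrivial B]
  π : C(X, ℂ) →⋆ₐ[ℂ] B
  V : unitary B
  covariant : ∀ f : C(X, ℂ), (V : B) * π f * star (V : B) = π (f.comp (φ.symm : C(X, X)))

attribute [instance] CovariantRep.cstar CovariantRep.nontriv

/-- The bounded product of the algebras `B` over all covariant pairs. -/
abbrev BigProduct (φ : X ≃ₜ X) : Type (u + 1) := lp (fun ρ : CovariantRep φ => ρ.B) ∞

/-- The family `(π(f))` indexed by all covariant pairs `(π, V)`. -/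
def bigι (φ : X ≃ₜ X) (f : C(X, ℂ)) : BigProduct φ :=
  ⟨fun ρ => ρ.π f, memℓp_infty ⟨‖f‖, by
    rintro _ ⟨ρ, rfl⟩; exact NonUnitalStarAlgHom.norm_apply_le ρ.π f⟩⟩

/-- The family `(V)` indexed by all covariant pairs `(π, V)`. -/
def bigU (φ : X ≃ₜ X) : BigProduct φ :=
  ⟨fun ρ => (ρ.V : ρ.B), memℓp_infty ⟨1, by
    rintro _ ⟨ρ, rfl⟩; exact (CStarRing.norm_coe_unitary ρ.V).le⟩⟩

/-- The closed `⋆`-subalgebra generated by the copy of `C(X)` and the unitary `(V)`. -/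
def crossedProductSubalgebra (φ : X ≃ₜ X) : StarSubalgebra ℂ (BigProduct φ) :=
  (StarAlgebra.adjoin ℂ (Set.range (bigι φ) ∪ {bigU φ})).topologicalClosure

/-- The crossed product `C(X) ⋊_φ ℤ`: the universal C⋆-algebra generated by a copy of `C(X)` and a
unitary `U` with `U f U⋆ = f ∘ φ⁻¹`. It is realized inside the bounded product over all covariant
pairs; pairs in the universe of `X` are enough, see `CrossedProduct.exists_unique_lift`. -/
def CrossedProduct (φ : X ≃ₜ X) : Type (u + 1) := crossedProductSubalgebra φ

instance crossedProductCStarAlgebra (φ : X ≃ₜ X) : CStarAlgebra (CrossedProduct φ) :=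
  StarSubalgebra.cstarAlgebra (crossedProductSubalgebra φ)
    (h_closed := StarSubalgebra.isClosed_topologicalClosure _)

namespace CrossedProduct

variable (φ : X ≃ₜ X)

variable {φ} in
theorem ext {a b : CrossedProduct φ} (h : ∀ ρ, a.1 ρ = b.1 ρ) : a = b :=
  Subtype.ext (lp.ext (funext h))

/-- The canonical map `C(X) → C(X) ⋊_φ ℤ`. -/
def ι : C(X, ℂ) →⋆ₐ[ℂ] CrossedProduct φ where
  toFun f := ⟨bigι φ f, StarSubalgebra.le_topologicalClosure _
    (StarAlgebra.subset_adjoin _ _ (Or.inl ⟨f, rfl⟩))⟩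
  map_one' := by apply ext; intro ρ; exact map_one ρ.π
  map_mul' f g := by apply ext; intro ρ; exact map_mul ρ.π f g
  map_zero' := by apply ext; intro ρ; exact map_zero ρ.π
  map_add' f g := by apply ext; intro ρ; exact map_add ρ.π f g
  commutes' r := by apply ext; intro ρ; exact AlgHomClass.commutes ρ.π r
  map_star' f := by apply ext; intro ρ; exact map_star ρ.π f

/-- The canonical unitary `U`. -/
def U : unitary (CrossedProduct φ) :=
  ⟨⟨bigU φ, StarSubalgebra.le_topologicalClosure _
    (StarAlgebra.subset_adjoin _ _ (Or.inr rfl))⟩,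
    Unitary.mem_iff.2 ⟨ext fun ρ => Unitary.coe_star_mul_self ρ.V,
      ext fun ρ => Unitary.coe_mul_star_self ρ.V⟩⟩

theorem U_mul_ι_mul_star (f : C(X, ℂ)) :
    (U φ : CrossedProduct φ) * ι φ f * star (U φ : CrossedProduct φ)
      = ι φ (f.comp (φ.symm : C(X, X))) := by
  apply ext; intro ρ; exact ρ.covariant f

variable {φ}

/-- The `⋆`-homomorphism given by a covariant pair. -/
def lift (ρ : CovariantRep φ) : CrossedProduct φ →⋆ₐ[ℂ] ρ.B where
  toFun a := a.1 ρ
  map_one' := rfl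
  map_mul' _ _ := rfl
  map_zero' := rfl
  map_add' _ _ := rfl
  commutes' _ := rfl
  map_star' _ := rfl

theorem lift_ι (ρ : CovariantRep φ) (f : C(X, ℂ)) : lift ρ (ι φ f) = ρ.π f := rfl
theorem lift_U (ρ : CovariantRep φ) : lift ρ (U φ : CrossedProduct φ) = ρ.V := rfl

/-- Induction over the generators `f`, `U`, `U⋆`, for closed properties. -/
theorem closed_induction {p : CrossedProduct φ → Prop} (hclosed : IsClosed {a | p a})
    (hι : ∀ f, p (ι φ f)) (hU : p (U φ)) (hU' : p (star (U φ : CrossedProduct φ)))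
    (add : ∀ a b, p a → p b → p (a + b)) (mul : ∀ a b, p a → p b → p (a * b))
    (a : CrossedProduct φ) : p a := by
  have key : ∀ b ∈ StarAlgebra.adjoin ℂ (Set.range (bigι φ) ∪ {bigU φ}),
      ∃ c : CrossedProduct φ, c.1 = b ∧ p c := by
    intro b hb
    refine Algebra.adjoin_induction
      (p := fun b _ => ∃ c : CrossedProduct φ, c.1 = b ∧ p c) ?_ ?_ ?_ ?_ hb
    · rintro x (( ⟨f, rfl⟩ | rfl) | (⟨f, hf⟩ | hx))
      · exact ⟨_, rfl, hι f⟩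
      · exact ⟨_, rfl, hU⟩
      · refine ⟨_, ?_, hι (star f)⟩
        rw [map_star, ← star_star x, ← hf]; rfl
      · refine ⟨_, ?_, hU'⟩
        rw [← star_star x, Set.mem_singleton_iff.1 hx]; rfl
    · intro r
      refine ⟨_, ?_, hι (algebraMap ℂ _ r)⟩
      rw [AlgHomClass.commutes]; rfl
    · rintro x y hx hy ⟨c, rfl, hc⟩ ⟨d, rfl, hd⟩; exact ⟨_, rfl, add _ _ hc hd⟩
    · rintro x y hx hy ⟨c, rfl, hc⟩ ⟨d, rfl, hd⟩; exact ⟨_, rfl, mul _ _ hc hd⟩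
  have hcl : IsClosed (Subtype.val '' {a : CrossedProduct φ | p a}) :=
    (StarSubalgebra.isClosed_topologicalClosure _).isClosedEmbedding_subtypeVal.isClosedMap _
      hclosed
  have hsub : ((StarAlgebra.adjoin ℂ (Set.range (bigι φ) ∪ {bigU φ}) :
      StarSubalgebra ℂ (BigProduct φ)) : Set (BigProduct φ)) ⊆
      Subtype.val '' {a : CrossedProduct φ | p a} := by
    intro b hb
    obtain ⟨c, rfl, hc⟩ := key b hb
    exact ⟨c, hc, rfl⟩
  obtain ⟨c, hc, hca⟩ := closure_minimal hsub hcl a.2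
  rwa [← Subtype.ext hca]

theorem hom_ext {B : Type*} [CStarAlgebra B] {σ τ : CrossedProduct φ →⋆ₐ[ℂ] B}
    (hι : ∀ f, σ (ι φ f) = τ (ι φ f)) (hU : σ (U φ) = τ (U φ)) : σ = τ := by
  ext a
  have hσ : Continuous σ := (NonUnitalStarAlgHom.instContinuousLinearMapClassComplex).map_continuous σ
  have hτ : Continuous τ := (NonUnitalStarAlgHom.instContinuousLinearMapClassComplex).map_continuous τ
  refine closed_induction (p := fun a => σ a = τ a) (isClosed_eq hσ hτ) hι hU ?_ ?_ ?_ a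
  · simp only [map_star, hU]
  · intro a b ha hb; simp only [map_add, ha, hb]
  · intro a b ha hb; simp only [map_mul, ha, hb]


/-- A C⋆-algebra that is small in the sense of cardinality has a copy in the given universe. -/
theorem exists_small_model (S : Type w) [CStarAlgebra S] [Small.{u} S] :
    ∃ (C : Type u) (_ : CStarAlgebra C), Nonempty (C ≃⋆ₐ[ℂ] S) := by
  let e : Shrink.{u} S ≃ₐ[ℂ] S := Shrink.algEquiv ℂ S
  let i1 : NormedRing (Shrink.{u} S) := NormedRing.induced _ S e e.injective
  have hn : ∀ x : Shrink.{u} S, ‖e x‖ = ‖x‖ := fun x => rfl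
  let i2 : NormedAlgebra ℂ (Shrink.{u} S) := NormedAlgebra.induced ℂ _ S e
  let i3 : StarRing (Shrink.{u} S) :=
    { star := fun x => e.symm (star (e x))
      star_involutive := fun x => by simp
      star_mul := fun x y => by simp
      star_add := fun x y => by simp }
  have hs : ∀ x : Shrink.{u} S, e (star x) = star (e x) := fun x => e.apply_symm_apply _
  have i4 : CStarRing (Shrink.{u} S) := ⟨fun x => by
    rw [← hn (star x * x), map_mul, hs, CStarRing.norm_star_mul_self, hn]⟩
  have i5 : StarModule ℂ (Shrink.{u} S) := ⟨fun r x => e.injective (by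
    rw [hs, map_smul, star_smul, map_smul, hs])⟩
  have i6 : CompleteSpace (Shrink.{u} S) := by
    have hi : Isometry e := AddMonoidHomClass.isometry_of_norm e hn
    exact (IsometryEquiv.mk e.toEquiv hi).completeSpace
  exact ⟨Shrink.{u} S, { }, ⟨{ e with map_star' := hs, map_smul' := map_smul e }⟩⟩

/-- **Universal property**: in whatever universe the unital C⋆-algebra `B` lives, every covariant
pair `(π, V)` in `B` factors through a unique `⋆`-homomorphism of `CrossedProduct φ`. -/
theorem exists_unique_lift {B : Type w} [CStarAlgebra B] (π : C(X, ℂ) →⋆ₐ[ℂ] B) (V : unitary B)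
    (hV : ∀ f : C(X, ℂ), (V : B) * π f * star (V : B) = π (f.comp (φ.symm : C(X, X)))) :
    ∃! σ : CrossedProduct φ →⋆ₐ[ℂ] B, (∀ f, σ (ι φ f) = π f) ∧ σ (U φ) = V := by
  refine existsUnique_of_exists_of_unique ?_ fun σ τ hσ hτ =>
    hom_ext (fun f => (hσ.1 f).trans (hτ.1 f).symm) (hσ.2.trans hτ.2.symm)
  rcases subsingleton_or_nontrivial B with hB | hB
  · exact ⟨{ toFun := fun _ => 0, map_one' := Subsingleton.elim _ _,
             map_mul' := fun _ _ => Subsingleton.elim _ _, map_zero' := rfl,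
             map_add' := fun _ _ => Subsingleton.elim _ _,
             commutes' := fun _ => Subsingleton.elim _ _,
             map_star' := fun _ => Subsingleton.elim _ _ },
      fun _ => Subsingleton.elim _ _, Subsingleton.elim _ _⟩
  let S := (StarAlgebra.adjoin ℂ (Set.range π ∪ {(V : B)})).topologicalClosure
  have hmem : Set.range π ∪ {(V : B)} ⊆ S :=
    (StarAlgebra.subset_adjoin _ _).trans (StarSubalgebra.le_topologicalClosure _)
  let iS : CStarAlgebra S :=
    StarSubalgebra.cstarAlgebra S (h_closed := StarSubalgebra.isClosed_topologicalClosure _)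
  have hsmall : Small.{u} S := by
    let g : C(X, ℂ) ⊕ Bool → B := Sum.elim π fun b => if b then (V : B) else star (V : B)
    have hle : ∀ b ∈ StarAlgebra.adjoin ℂ (Set.range π ∪ {(V : B)}),
        ∃ c, FreeAlgebra.lift ℂ g c = b := by
      intro b hb
      have hg : (Set.range π ∪ {(V : B)}) ∪ star (Set.range π ∪ {(V : B)}) ⊆
          (FreeAlgebra.lift ℂ g).range := by
        rintro x ((⟨f, rfl⟩ | rfl) | (⟨f, hf⟩ | hx))
        · exact ⟨FreeAlgebra.ι ℂ (Sum.inl f), by simp [g]⟩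
        · exact ⟨FreeAlgebra.ι ℂ (Sum.inr true), by simp [g]⟩
        · exact ⟨FreeAlgebra.ι ℂ (Sum.inl (star f)), (FreeAlgebra.lift_ι_apply g _).trans (by
            change π (star f) = x
            rw [map_star, hf, star_star])⟩
        · exact ⟨FreeAlgebra.ι ℂ (Sum.inr false), by
            simp [g, ← Set.mem_singleton_iff.1 hx]⟩
      exact Algebra.adjoin_le hg hb
    have hrange : (S : Set B) ⊆ Set.range fun s : ℕ → FreeAlgebra ℂ (C(X, ℂ) ⊕ Bool) =>
        Filter.limUnder Filter.atTop fun n => FreeAlgebra.lift ℂ g (s n) := by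
      intro b hb
      obtain ⟨s, hs, hsb⟩ := mem_closure_iff_seq_limit.1 hb
      choose c hc using fun n => hle (s n) (hs n)
      exact ⟨c, by simpa only [hc] using hsb.limUnder_eq⟩
    exact small_subset hrange
  obtain ⟨C, iC, ⟨e⟩⟩ := exists_small_model.{u} S
  have hCn : Nontrivial C := e.toEquiv.nontrivial
  let π' : C(X, ℂ) →⋆ₐ[ℂ] S :=
    StarAlgHom.codRestrict π S fun f => hmem (Or.inl ⟨f, rfl⟩)
  let V' : S := ⟨V, hmem (Or.inr rfl)⟩
  have hV' : V' ∈ unitary S := Unitary.mem_iff.2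
    ⟨Subtype.ext (Unitary.coe_star_mul_self V), Subtype.ext (Unitary.coe_mul_star_self V)⟩
  let ρ : CovariantRep φ :=
    { B := C
      π := (e.symm : S →⋆ₐ[ℂ] C).comp π'
      V := ⟨e.symm V', Unitary.map_mem e.symm hV'⟩
      covariant := fun f => by
        have h : V' * π' f * star V' = π' (f.comp (φ.symm : C(X, X))) := Subtype.ext (hV f)
        change e.symm V' * e.symm (π' f) * star (e.symm V') =
          e.symm (π' (f.comp (φ.symm : C(X, X))))
        rw [← h, map_mul, map_mul, map_star] }
  refine ⟨(S.subtype.comp (e : C →⋆ₐ[ℂ] S)).comp (lift ρ), fun f => ?_, ?_⟩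
  · change ((e (e.symm (π' f)) : S) : B) = π f
    rw [e.apply_symm_apply]; rfl
  · change ((e (e.symm V') : S) : B) = V
    rw [e.apply_symm_apply]

/-! ### The flow -/

/-- The unitary function `e^{-itF}`. -/
def phase (F : C(X, ℝ)) (t : ℝ) : unitary C(X, ℂ) :=
  ⟨⟨fun x => Complex.exp (-(Complex.I * t * F x)), by fun_prop⟩, by
    have h : ∀ x, (starRingEnd ℂ) (Complex.exp (-(Complex.I * t * F x))) *
        Complex.exp (-(Complex.I * t * F x)) = 1 := fun x => by
      rw [← Complex.exp_conj, ← Complex.exp_add]; simp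
    refine Unitary.mem_iff.2 ⟨?_, ?_⟩ <;> ext x
    · exact h x
    · exact (mul_comm _ _).trans (h x)⟩

/-- The covariant pair `(π, V π(w))`, for a unitary `w ∈ C(X)`. -/
def twistRep (ρ : CovariantRep φ) (w : unitary C(X, ℂ)) : CovariantRep φ where
  B := ρ.B
  π := ρ.π
  V := ρ.V * ⟨ρ.π w, Unitary.map_mem ρ.π w.2⟩
  covariant f := by
    have h : ρ.π w * ρ.π f * star (ρ.π (w : C(X, ℂ))) = ρ.π f := by
      rw [← map_star, ← map_mul, ← map_mul, mul_comm (w : C(X, ℂ)) f, mul_assoc,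
        Unitary.mul_star_self_of_mem w.2, mul_one]
    calc _ = (ρ.V : ρ.B) * (ρ.π w * ρ.π f * star (ρ.π (w : C(X, ℂ)))) * star (ρ.V : ρ.B) := by
          simp [mul_assoc]
      _ = _ := by rw [h, ρ.covariant f]

/-- Composition with `(π, V) ↦ (π, V π(w))` on the bounded product. -/
def bigTwist (φ : X ≃ₜ X) (w : unitary C(X, ℂ)) : BigProduct φ →⋆ₐ[ℂ] BigProduct φ where
  toFun a := ⟨fun ρ => a (twistRep ρ w), memℓp_infty ⟨‖a‖, by
    rintro _ ⟨ρ, rfl⟩; exact lp.norm_apply_le_norm ENNReal.top_ne_zero a _⟩⟩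
  map_one' := rfl
  map_mul' _ _ := rfl
  map_zero' := rfl
  map_add' _ _ := rfl
  commutes' _ := rfl
  map_star' _ := rfl

theorem bigTwist_mem (w : unitary C(X, ℂ)) (a : CrossedProduct φ) :
    bigTwist φ w a.1 ∈ crossedProductSubalgebra φ := by
  have hc : Continuous (bigTwist φ w) :=
    (NonUnitalStarAlgHom.instContinuousLinearMapClassComplex).map_continuous (bigTwist φ w)
  refine closed_induction (p := fun a => bigTwist φ w a.1 ∈ crossedProductSubalgebra φ)
    ?_ ?_ ?_ ?_ ?_ ?_ a
  · exact (StarSubalgebra.isClosed_topologicalClosure _).preimage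
      (hc.comp continuous_subtype_val)
  · exact fun f => (ι φ f).2
  · exact ((U φ : CrossedProduct φ) * ι φ w).2
  · exact (star ((U φ : CrossedProduct φ) * ι φ w)).2
  · intro a b ha hb
    exact add_mem ha hb
  · intro a b ha hb
    exact mul_mem ha hb

/-- The endomorphism determined by `f ↦ f` and `U ↦ U w`, for a unitary `w ∈ C(X)`. -/
def twist (φ : X ≃ₜ X) (w : unitary C(X, ℂ)) : CrossedProduct φ →⋆ₐ[ℂ] CrossedProduct φ where
  toFun a := ⟨bigTwist φ w a.1, bigTwist_mem w a⟩
  map_one' := rfl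
  map_mul' _ _ := rfl
  map_zero' := rfl
  map_add' _ _ := rfl
  commutes' _ := rfl
  map_star' _ := rfl

theorem twist_ι (w : unitary C(X, ℂ)) (f : C(X, ℂ)) : twist φ w (ι φ f) = ι φ f := rfl

theorem twist_U (w : unitary C(X, ℂ)) :
    twist φ w (U φ : CrossedProduct φ) = (U φ : CrossedProduct φ) * ι φ w := rfl

theorem twist_twist (v w : unitary C(X, ℂ)) :
    (twist φ v).comp (twist φ w) = twist φ (v * w) := by
  refine hom_ext (fun f => rfl) ?_
  simp [twist_U, twist_ι, mul_assoc]

theorem twist_one : twist φ 1 = StarAlgHom.id ℂ (CrossedProduct φ) := by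
  refine hom_ext (fun f => rfl) ?_
  simp [twist_U]

/-- The flow `α^F` on `C(X) ⋊_φ ℤ`, determined by `α^F_t(f U) = f U e^{-itF}`. -/
def flow (φ : X ≃ₜ X) (F : C(X, ℝ)) (t : ℝ) : CrossedProduct φ ≃⋆ₐ[ℂ] CrossedProduct φ :=
  StarAlgEquiv.ofStarAlgHom (twist φ (phase F t)) (twist φ (star (phase F t)))
    (by rw [twist_twist, Unitary.star_mul_self, twist_one])
    (by rw [twist_twist, Unitary.mul_star_self, twist_one])

theorem flow_ι_mul_U (F : C(X, ℝ)) (t : ℝ) (f : C(X, ℂ)) :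
    flow φ F t (ι φ f * (U φ : CrossedProduct φ)) =
      ι φ f * (U φ : CrossedProduct φ) * ι φ (phase F t : C(X, ℂ)) := by
  rw [mul_assoc]; rfl

theorem flow_ι (F : C(X, ℝ)) (t : ℝ) (f : C(X, ℂ)) : flow φ F t (ι φ f) = ι φ f := rfl

/-! ### The conditional expectation

For `x ∈ X` let `C(X) ⋊_φ ℤ` act on `ℓ²(ℤ)` by `(f ξ)(n) = f(φⁿ x) ξ(n)` and
`(U ξ)(n) = ξ(n - 1)`. Then `E(a)(x)` is the `(0, 0)` matrix coefficient of `a`.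
-/

/-- The Hilbert space `ℓ²(ℤ)`, in the universe `u`. -/
abbrev ellTwo : Type u := lp (fun _ : ULift.{u} ℤ => ℂ) 2

/-- Multiplication by a bounded sequence. -/
def diagOp (d : ULift.{u} ℤ → ℂ) (K : ℝ) (hK : 0 ≤ K) (hd : ∀ n, ‖d n‖ ≤ K) :
    ellTwo.{u} →L[ℂ] ellTwo.{u} :=
  lp.mapCLM 2 (fun n => d n • ContinuousLinearMap.id ℂ ℂ) hK (fun n => by
    simpa [norm_smul] using hd n)

theorem diagOp_apply (d : ULift.{u} ℤ → ℂ) (K : ℝ) (hK : 0 ≤ K) (hd : ∀ n, ‖d n‖ ≤ K)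
    (ξ : ellTwo.{u}) (n : ULift.{u} ℤ) : diagOp d K hK hd ξ n = d n * ξ n := rfl

/-- Translation by `k`. -/
def translate (k : ℤ) : ellTwo.{u} →ₗᵢ[ℂ] ellTwo.{u} where
  toFun ξ := ⟨fun n => ξ ⟨n.down - k⟩, by
    have h := (lp.memℓp ξ).summable (by norm_num)
    refine memℓp_gen ?_
    exact h.comp_injective (i := fun n : ULift.{u} ℤ => (⟨n.down - k⟩ : ULift.{u} ℤ))
      (fun a b hab => ULift.ext _ _ (sub_left_injective (congrArg ULift.down hab)))⟩
  map_add' _ _ := rfl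
  map_smul' _ _ := rfl
  norm_map' ξ := by
    rw [lp.norm_eq_tsum_rpow (by norm_num), lp.norm_eq_tsum_rpow (by norm_num)]
    congr 1
    exact ((Equiv.ulift.trans (Equiv.subRight k)).trans Equiv.ulift.symm).tsum_eq
      (fun n : ULift.{u} ℤ => ‖ξ n‖ ^ (2 : ℝ≥0∞).toReal)

theorem translate_apply (k : ℤ) (ξ : ellTwo.{u}) (n : ULift.{u} ℤ) :
    translate k ξ n = ξ ⟨n.down - k⟩ := rfl

/-- The bilateral shift. -/
def shiftEquiv : ellTwo.{u} ≃ₗᵢ[ℂ] ellTwo.{u} :=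
  { translate 1 with
    invFun := translate (-1)
    left_inv := fun ξ => lp.ext (funext fun n => by simp [translate_apply])
    right_inv := fun ξ => lp.ext (funext fun n => by simp [translate_apply]) }

theorem shiftEquiv_apply (ξ : ellTwo.{u}) (n : ULift.{u} ℤ) :
    shiftEquiv ξ n = ξ ⟨n.down - 1⟩ := rfl

/-- `C(X)` acting on `ℓ²(ℤ)` along the orbit of `x`. -/
def orbitRep (φ : X ≃ₜ X) (x : X) : C(X, ℂ) →⋆ₐ[ℂ] (ellTwo.{u} →L[ℂ] ellTwo.{u}) where
  toFun f := diagOp (fun n => f ((φ ^ n.down) x)) ‖f‖ (norm_nonneg f)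
    (fun n => f.norm_coe_le_norm _)
  map_one' := by ext ξ n; simp [diagOp_apply]
  map_mul' f g := by ext ξ n; simp [diagOp_apply, mul_assoc]
  map_zero' := by ext ξ n; simp [diagOp_apply]
  map_add' f g := by ext ξ n; simp [diagOp_apply, add_mul]
  commutes' r := by ext ξ n; simp [diagOp_apply, Algebra.algebraMap_eq_smul_one]
  map_star' f := by
    rw [ContinuousLinearMap.star_eq_adjoint, ContinuousLinearMap.eq_adjoint_iff]
    intro ξ η
    rw [lp.inner_eq_tsum, lp.inner_eq_tsum]
    refine tsum_congr fun n => ?_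
    simp [diagOp_apply]
    ring


/-- The standard basis vector `δ_n`. -/
def basisVec (n : ℤ) : ellTwo.{u} := lp.single 2 (⟨n⟩ : ULift.{u} ℤ) (1 : ℂ)

theorem basisVec_apply (n : ℤ) (m : ULift.{u} ℤ) :
    basisVec.{u} n m = if m.down = n then 1 else 0 := by
  by_cases h : m = ⟨n⟩
  · subst h; simp [basisVec]
  · have h' : m.down ≠ n := fun e => h (ULift.ext _ _ e)
    rw [if_neg h']
    exact lp.single_apply_ne 2 _ _ h

instance : Nontrivial ellTwo.{u} :=
  ⟨⟨basisVec 0, 0, fun h => by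
    have := congrArg (fun ξ : ellTwo.{u} => ξ ⟨0⟩) h
    simp [basisVec_apply] at this⟩⟩

theorem orbitRep_apply (φ : X ≃ₜ X) (x : X) (f : C(X, ℂ)) (ξ : ellTwo.{u}) (n : ULift.{u} ℤ) :
    orbitRep φ x f ξ n = f ((φ ^ n.down) x) * ξ n := rfl

/-- The covariant pair on `ℓ²(ℤ)` given by the orbit of `x`. -/
def regularRep (φ : X ≃ₜ X) (x : X) : CovariantRep φ where
  B := ellTwo.{u} →L[ℂ] ellTwo.{u}
  nontriv := inferInstance
  π := orbitRep φ x
  V := Unitary.linearIsometryEquiv.symm shiftEquiv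
  covariant f := by
    have h : ((Unitary.linearIsometryEquiv.symm shiftEquiv :
        unitary (ellTwo.{u} →L[ℂ] ellTwo.{u})) : ellTwo.{u} →L[ℂ] ellTwo.{u}) * orbitRep φ x f =
        orbitRep φ x (f.comp (φ.symm : C(X, X))) *
          (Unitary.linearIsometryEquiv.symm shiftEquiv :
            unitary (ellTwo.{u} →L[ℂ] ellTwo.{u})) := by
      refine ContinuousLinearMap.ext fun ξ => lp.ext (funext fun n => ?_)
      change f ((φ ^ (n.down - 1)) x) * ξ ⟨n.down - 1⟩ =
        f (φ.symm ((φ ^ n.down) x)) * ξ ⟨n.down - 1⟩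
      congr 2
      rw [sub_eq_neg_add, zpow_add, zpow_neg_one]
      rfl
    rw [h, mul_assoc, Unitary.mul_star_self_of_mem (Subtype.prop _), mul_one]

/-- The representation of `C(X) ⋊_φ ℤ` on `ℓ²(ℤ)` given by the orbit of `x`. -/
def reg (φ : X ≃ₜ X) (x : X) : CrossedProduct φ →⋆ₐ[ℂ] (ellTwo.{u} →L[ℂ] ellTwo.{u}) :=
  lift (regularRep φ x)

theorem reg_ι_apply (x : X) (f : C(X, ℂ)) (ξ : ellTwo.{u}) (n : ULift.{u} ℤ) :
    reg φ x (ι φ f) ξ n = f ((φ ^ n.down) x) * ξ n := rfl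

theorem reg_U_apply (x : X) (ξ : ellTwo.{u}) (n : ULift.{u} ℤ) :
    reg φ x (U φ : CrossedProduct φ) ξ n = ξ ⟨n.down - 1⟩ := rfl

theorem norm_reg_apply_le (x : X) (a : CrossedProduct φ) (ξ : ellTwo.{u}) :
    ‖reg φ x a ξ‖ ≤ ‖a‖ * ‖ξ‖ :=
  (reg φ x a).le_of_opNorm_le (NonUnitalStarAlgHom.norm_apply_le (reg φ x) a) ξ

theorem reg_ι_basisVec (x : X) (f : C(X, ℂ)) (n : ℤ) :
    reg φ x (ι φ f) (basisVec n) = f ((φ ^ n) x) • basisVec.{u} n := by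
  refine lp.ext (funext fun m => ?_)
  change f ((φ ^ m.down) x) * basisVec.{u} n m = f ((φ ^ n) x) * basisVec.{u} n m
  rw [basisVec_apply]
  split_ifs with h
  · rw [h]
  · simp

theorem reg_U_basisVec (x : X) (n : ℤ) :
    reg φ x (U φ : CrossedProduct φ) (basisVec n) = basisVec.{u} (n + 1) := by
  refine lp.ext (funext fun m => ?_)
  rw [reg_U_apply]
  simp only [basisVec_apply, sub_eq_iff_eq_add]

theorem continuous_of_approx {Z Y : Type*} [TopologicalSpace Z] [NormedAddCommGroup Y]
    {g : Z → Y} (h : ∀ ε > 0, ∃ g' : Z → Y, Continuous g' ∧ ∀ x, ‖g x - g' x‖ < ε) :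
    Continuous g := by
  refine continuous_of_uniform_approx_of_continuous fun u hu => ?_
  obtain ⟨ε, hε, hεu⟩ := Metric.mem_uniformity_dist.1 hu
  obtain ⟨g', hg', hgg'⟩ := h ε hε
  exact ⟨g', hg', fun y => hεu (by rw [dist_eq_norm]; exact hgg' y)⟩

theorem continuous_reg_ι_apply (f : C(X, ℂ)) (ξ : ellTwo.{u}) :
    Continuous fun x => reg φ x (ι φ f) ξ := by
  refine continuous_of_approx fun ε hε => ?_
  have hC : 0 < ‖ι φ f‖ + 1 := by positivity
  obtain ⟨s, hs⟩ := ((Metric.tendsto_nhds.1 (lp.hasSum_single ENNReal.ofNat_ne_top ξ))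
    (ε / (‖ι φ f‖ + 1)) (by positivity)).exists
  refine ⟨fun x => reg φ x (ι φ f) (∑ i ∈ s, lp.single 2 i (ξ i)), ?_, fun x => ?_⟩
  · simp only [map_sum]
    refine continuous_finsetSum _ fun i _ => ?_
    have h : ∀ x, reg φ x (ι φ f) (lp.single 2 i (ξ i)) =
        f ((φ ^ i.down) x) • (lp.single 2 i (ξ i) : ellTwo.{u}) := by
      intro x
      refine lp.ext (funext fun m => ?_)
      change f ((φ ^ m.down) x) * (lp.single 2 i (ξ i) : ellTwo.{u}) m =
        f ((φ ^ i.down) x) * (lp.single 2 i (ξ i) : ellTwo.{u}) m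
      by_cases hm : m = i
      · rw [hm]
      · rw [lp.single_apply_ne 2 _ _ hm, mul_zero, mul_zero]
    simp only [h]
    exact (f.continuous.comp (φ ^ i.down).continuous).smul continuous_const
  · rw [← map_sub]
    rw [dist_comm, dist_eq_norm] at hs
    calc _ ≤ ‖ι φ f‖ * ‖ξ - ∑ i ∈ s, lp.single 2 i (ξ i)‖ := norm_reg_apply_le _ _ _
      _ ≤ (‖ι φ f‖ + 1) * ‖ξ - ∑ i ∈ s, lp.single 2 i (ξ i)‖ := by gcongr; linarith
      _ < (‖ι φ f‖ + 1) * (ε / (‖ι φ f‖ + 1)) := by gcongr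
      _ = ε := by field_simp

theorem continuous_reg_apply (a : CrossedProduct φ) (ξ : ellTwo.{u}) :
    Continuous fun x => reg φ x a ξ := by
  refine closed_induction (p := fun a => ∀ ξ : ellTwo.{u}, Continuous fun x => reg φ x a ξ)
    ?_ continuous_reg_ι_apply ?_ ?_ ?_ ?_ a ξ
  · refine isClosed_of_closure_subset fun a ha ξ => continuous_of_approx fun ε hε => ?_
    obtain ⟨b, hb, hab⟩ := Metric.mem_closure_iff.1 ha (ε / (‖ξ‖ + 1)) (by positivity)
    refine ⟨_, hb ξ, fun x => ?_⟩
    rw [← sub_apply, ← map_sub]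
    rw [dist_eq_norm] at hab
    calc _ ≤ ‖a - b‖ * ‖ξ‖ := norm_reg_apply_le _ _ _
      _ ≤ ‖a - b‖ * (‖ξ‖ + 1) := by gcongr; linarith
      _ < ε / (‖ξ‖ + 1) * (‖ξ‖ + 1) := by gcongr
      _ = ε := by field_simp
  · intro ξ
    exact continuous_const
  · intro ξ
    have : ∀ x y : X, reg φ x (star (U φ : CrossedProduct φ)) ξ =
        reg φ y (star (U φ : CrossedProduct φ)) ξ := fun x y => rfl
    exact continuous_of_const this
  · intro a b ha hb ξ
    simp only [map_add, add_apply]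
    exact (ha ξ).add (hb ξ)
  · intro a b ha hb ξ
    simp only [map_mul, mul_apply_eq_comp]
    rw [continuous_iff_continuousAt]
    intro x₀
    have h1 : Filter.Tendsto (fun x => reg φ x a (reg φ x₀ b ξ)) (nhds x₀)
        (nhds (reg φ x₀ a (reg φ x₀ b ξ))) := (ha _).continuousAt
    have h2 : Filter.Tendsto (fun x => ‖a‖ * ‖reg φ x b ξ - reg φ x₀ b ξ‖) (nhds x₀)
        (nhds 0) := by
      have h3 : Filter.Tendsto (fun x => reg φ x b ξ - reg φ x₀ b ξ) (nhds x₀) (nhds 0) := by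
        have h4 : Filter.Tendsto (fun x => reg φ x b ξ) (nhds x₀) (nhds (reg φ x₀ b ξ)) :=
          (hb ξ).continuousAt
        simpa using h4.sub_const (reg φ x₀ b ξ)
      simpa using h3.norm.const_mul ‖a‖
    have h5 : Filter.Tendsto (fun x => reg φ x a (reg φ x b ξ - reg φ x₀ b ξ)) (nhds x₀)
        (nhds 0) := squeeze_zero_norm (fun x => norm_reg_apply_le _ _ _) h2
    have h6 := h5.add h1
    simpa [ContinuousAt, map_sub] using h6

/-- The canonical conditional expectation `E : C(X) ⋊_φ ℤ → C(X)`, with `E(f) = f` and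
`E(f Uⁿ) = 0` for `n ≠ 0`. -/
def E (φ : X ≃ₜ X) : CrossedProduct φ →ₗ[ℂ] C(X, ℂ) where
  toFun a := ⟨fun x => reg φ x a (basisVec 0) (⟨0⟩ : ULift.{u} ℤ),
    (lp.evalCLM ℂ (fun _ : ULift.{u} ℤ => ℂ) 2 ⟨0⟩).continuous.comp
      (continuous_reg_apply a (basisVec 0))⟩
  map_add' _ _ := rfl
  map_smul' _ _ := rfl

theorem E_ι_mul_U_zpow (f : C(X, ℂ)) (n : ℤ) :
    E φ (ι φ f * ((U φ ^ n : unitary (CrossedProduct φ)) : CrossedProduct φ)) =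
      if n = 0 then f else 0 := by
  have hU : ∀ (x : X) (n k : ℤ), reg φ x
      ((U φ ^ n : unitary (CrossedProduct φ)) : CrossedProduct φ) (basisVec k) =
        basisVec.{u} (k + n) := by
    intro x n
    have hmul : ∀ (p q : unitary (CrossedProduct φ)) (ξ : ellTwo.{u}),
        reg φ x ((p * q : unitary (CrossedProduct φ)) : CrossedProduct φ) ξ =
          reg φ x (p : CrossedProduct φ) (reg φ x (q : CrossedProduct φ) ξ) := by
      intro p q ξ
      rw [Submonoid.coe_mul, map_mul]; rfl
    induction n with
    | zero => intro k; simp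
    | succ j ih =>
      intro k
      rw [zpow_add_one, hmul, reg_U_basisVec, ih]
      congr 1; ring
    | pred j ih =>
      intro k
      have h := hmul (U φ ^ (-(j : ℤ) - 1)) (U φ) (basisVec (k - 1))
      rw [← zpow_add_one, sub_add_cancel, ih, reg_U_basisVec, sub_add_cancel] at h
      rw [← h]
      congr 1; ring
  ext x
  change reg φ x (ι φ f * ((U φ ^ n : unitary (CrossedProduct φ)) : CrossedProduct φ))
    (basisVec 0) ⟨0⟩ = _
  rw [map_mul, mul_apply_eq_comp, hU, reg_ι_apply, basisVec_apply]
  by_cases hn : n = 0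
  · subst hn; simp
  · simp [hn, Ne.symm hn]

end CrossedProduct

end CrossedProduct

section KMS

variable {A : Type*} [CStarAlgebra A]

/-- A state: a positive linear functional with `ω(1) = 1`. Elements of `WeakDual ℂ A` are the
continuous functionals, with the weak-⋆ topology. -/
def IsState (ω : WeakDual ℂ A) : Prop :=
  (∀ a : A, 0 ≤ ω (star a * a)) ∧ ω 1 = 1

/-- `g` is the entire extension `z ↦ α_z(a)` of the orbit `t ↦ α_t(a)`; an element with such an
extension is analytic for `α`. -/
def IsEntireExtension (α : ℝ → A ≃⋆ₐ[ℂ] A) (a : A) (g : ℂ → A) : Prop :=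
  Differentiable ℂ g ∧ ∀ t : ℝ, g (t : ℂ) = α t a

/-- A state `ω` is a `β`-KMS state for `α` when `ω(a b) = ω(b α_{iβ}(a))` for all `a`, `b` in a
dense `α`-invariant `⋆`-subalgebra of `α`-analytic elements. -/
def IsKMSState (α : ℝ → A ≃⋆ₐ[ℂ] A) (β : ℝ) (ω : WeakDual ℂ A) : Prop :=
  IsState ω ∧ ∃ D : NonUnitalStarSubalgebra ℂ A,
    Dense (D : Set A) ∧ (∀ t : ℝ, ∀ a ∈ D, α t a ∈ D) ∧
    ∀ a ∈ D, ∃ g : ℂ → A, IsEntireExtension α a g ∧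
      ∀ b ∈ D, ω (a * b) = ω (b * g (Complex.I * β))

/-- The set of `β`-KMS states for `α`. -/
def kmsStates (α : ℝ → A ≃⋆ₐ[ℂ] A) (β : ℝ) : Set (WeakDual ℂ A) :=
  {ω | IsKMSState α β ω}

end KMS

section Dynamics

variable {X : Type*} [TopologicalSpace X]

/-- A homeomorphism is minimal when all its orbits `{φⁿ(x) : n ∈ ℤ}` are dense. -/
def IsMinimalHomeo (φ : X ≃ₜ X) : Prop :=
  ∀ x : X, Dense (Set.range fun n : ℤ => (φ ^ n) x)

variable [MeasurableSpace X]

/-- The `e^{βF}`-conformal measures: the Borel probability measures `m` with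
`m(φ(B)) = ∫_B e^{βF} dm` for all Borel sets `B`. -/
def conformalMeasures (φ : X ≃ₜ X) (F : C(X, ℝ)) (β : ℝ) : Set (ProbabilityMeasure X) :=
  {m | ∀ B : Set X, MeasurableSet B →
    (m : Measure X) (φ '' B) = ∫⁻ x in B, ENNReal.ofReal (Real.exp (β * F x)) ∂(m : Measure X)}

end Dynamics

end KMSCrossed

end

open KMSCrossed

/-!
The flow fixes `C(X)` pointwise, so a KMS state `ω` satisfies `ω(g a) = ω(a g)` for `g ∈ C(X)`; with
`a = h Uⁿ` this says that `ω` vanishes on `h (g ∘ φ⁻ⁿ - g) Uⁿ`. When `φⁿ` has no fixed points, no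
maximal ideal of `C(X)` contains all the functions `g ∘ φ⁻ⁿ - g`, so `ω` vanishes on `C(X) Uⁿ`.
Hence `ω = ω ∘ E`, and `ω` is determined by the measure `m` representing its restriction to `C(X)`.

The KMS condition for the pair `U`, `f U⋆` reads `∫ f ∘ φ⁻¹ dm = ∫ e^{βF} f dm`, which is
conformality of `m` tested against continuous functions. Conversely, if `m` is conformal, then
`a ↦ ∫ E(a) dm` satisfies the KMS condition at `f` and `U`, hence on the `⋆`-algebra they generate.

The definition provides the KMS condition only on some dense algebra of analytic elements, which
need not contain `f` and `U`. For `β ≠ 0` it extends to every analytic `a`: if `b` lies in the dense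
algebra, then `ω(a b) = ω(α_{iβ}(a b)) = ω(α_{iβ}(a) α_{iβ}(b)) = ω(b α_{iβ}(a))`, where the first
equality holds because `z ↦ ω(α_z(a b))` is constant, and the last is the KMS condition for `b`.
-/

noncomputable section

open Filter Topology Set
open scoped CStarAlgebra

namespace KMSCrossed

section OneParameterGroup

/-- A family `t ↦ α_t` of `⋆`-automorphisms is a one-parameter group when `α_{s+t} = α_s ∘ α_t`.
No continuity in `t` is asked for: elements with an entire extension of their orbit have a
continuous orbit anyway. -/
def IsOneParameterGroup {A : Type*} [CStarAlgebra A] (α : ℝ → A ≃⋆ₐ[ℂ] A) : Prop :=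
  ∀ s t a, α (s + t) a = α s (α t a)

theorem eq_of_eqOn_real {E : Type*} [NormedAddCommGroup E] [NormedSpace ℂ E] [CompleteSpace E]
    {f g : ℂ → E} (hf : Differentiable ℂ f) (hg : Differentiable ℂ g)
    (hfg : ∀ t : ℝ, f t = g t) : f = g := by
  have htendsto : Tendsto (fun t : ℝ => (t : ℂ)) (𝓝[≠] 0) (𝓝[≠] 0) := by
    refine tendsto_nhdsWithin_iff.2 ⟨?_, ?_⟩
    · exact (Complex.continuous_ofReal.tendsto' 0 0 rfl).mono_left nhdsWithin_le_nhds
    · filter_upwards [self_mem_nhdsWithin] with t ht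
      simpa using ht
  exact AnalyticOnNhd.eq_of_frequently_eq (z₀ := 0) (fun z _ => hf.analyticAt z)
    (fun z _ => hg.analyticAt z) (htendsto.frequently (Eventually.of_forall hfg).frequently)

theorem differentiable_starAlgHom_comp {A B : Type*} [CStarAlgebra A] [CStarAlgebra B]
    (π : A →⋆ₐ[ℂ] B) {g : ℂ → A} (hg : Differentiable ℂ g) : Differentiable ℂ fun z => π (g z) :=
  (ContinuousLinearMap.differentiable (𝕜 := ℂ)
    ⟨π.toAlgHom.toLinearMap, map_continuous π⟩).comp hg

variable {A : Type*} [CStarAlgebra A]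

theorem differentiable_weakDual_comp (ω : WeakDual ℂ A) {g : ℂ → A} (hg : Differentiable ℂ g) :
    Differentiable ℂ fun z => ω (g z) :=
  (WeakDual.toStrongDual ω).differentiable.comp hg

namespace IsEntireExtension

variable {α : ℝ → A ≃⋆ₐ[ℂ] A} {a b : A} {g h : ℂ → A}

protected theorem unique (hg : IsEntireExtension α a g) (hh : IsEntireExtension α a h) : g = h :=
  eq_of_eqOn_real hg.1 hh.1 fun t => (hg.2 t).trans (hh.2 t).symm

protected theorem add (hg : IsEntireExtension α a g) (hh : IsEntireExtension α b h) :
    IsEntireExtension α (a + b) fun z => g z + h z :=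
  ⟨hg.1.add hh.1, fun t => by simp only [hg.2, hh.2, map_add]⟩

protected theorem mul (hg : IsEntireExtension α a g) (hh : IsEntireExtension α b h) :
    IsEntireExtension α (a * b) fun z => g z * h z :=
  ⟨hg.1.mul hh.1, fun t => by simp only [hg.2, hh.2, map_mul]⟩

protected theorem smul (r : ℂ) (hg : IsEntireExtension α a g) :
    IsEntireExtension α (r • a) fun z => r • g z :=
  ⟨hg.1.const_smul r, fun t => by simp only [hg.2, map_smul]⟩

protected theorem star (hg : IsEntireExtension α a g) :
    IsEntireExtension α (star a) fun z => star (g (star z)) := by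
  have hreal (t : ℝ) : star (t : ℂ) = t := Complex.conj_ofReal t
  refine ⟨fun z => ?_, fun t => by simp only [hreal, hg.2, map_star]⟩
  have hz := (hg.1 (star z)).star_star
  rwa [star_star] at hz

theorem apply_zero (hα : IsOneParameterGroup α) (hg : IsEntireExtension α a g) : g 0 = a := by
  have hzero : α 0 a = a := EquivLike.injective (α 0) (by rw [← hα, add_zero])
  rw [← Complex.ofReal_zero, hg.2, hzero]

theorem apply_real_add (hα : IsOneParameterGroup α) (hg : IsEntireExtension α a g)
    (s : ℝ) (z : ℂ) : g (s + z) = α s (g z) :=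
  congrFun (eq_of_eqOn_real (f := fun z => g (s + z)) (hg.1.comp (differentiable_id.const_add _))
    (differentiable_starAlgHom_comp (α s : A →⋆ₐ[ℂ] A) hg.1)
    fun t => by rw [← Complex.ofReal_add, hg.2, hα, hg.2]; rfl) z

theorem comp_real_add (hα : IsOneParameterGroup α) (hg : IsEntireExtension α a g) (s : ℝ) :
    IsEntireExtension α (α s a) fun z => g (s + z) :=
  ⟨hg.1.comp (differentiable_id.const_add _), fun t => by
    beta_reduce
    rw [← Complex.ofReal_add, hg.2, add_comm, hα]⟩

theorem exists_norm_le_on_strip (hα : IsOneParameterGroup α) (hg : IsEntireExtension α a g)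
    (β : ℝ) : ∃ K, ∀ s : ℝ, ∀ t ∈ uIcc 0 β, ‖g (s + t * Complex.I)‖ ≤ K := by
  have hcont : Continuous fun t : ℝ => g (t * Complex.I) := hg.1.continuous.comp (by fun_prop)
  obtain ⟨K, hK⟩ := isCompact_uIcc.exists_bound_of_continuousOn hcont.continuousOn
  exact ⟨K, fun s t ht => by
    rw [hg.apply_real_add hα, StarAlgEquiv.norm_map]
    exact hK t ht⟩

end IsEntireExtension

end OneParameterGroup

section State

variable {A : Type*} [CStarAlgebra A] {ω : WeakDual ℂ A}

theorem IsState.apply_star (hω : IsState ω) (a : A) : ω (star a) = star (ω a) := by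
  have him_add : ∀ a, (ω a).im + (ω (star a)).im = 0 := fun a => by
    have hsq := (Complex.nonneg_iff.1 (hω.1 a)).2
    have hsq_one := (Complex.nonneg_iff.1 (hω.1 (a + 1))).2
    have hexpand : star (a + 1) * (a + 1) = star a * a + a + star a + 1 := by
      rw [star_add, star_one]; noncomm_ring
    rw [hexpand, map_add, map_add, map_add, hω.2] at hsq_one
    simp only [Complex.add_im, Complex.one_im] at hsq_one
    linarith
  have hre_sub : (ω a).re - (ω (star a)).re = 0 := by
    simpa [star_smul, sub_eq_add_neg] using him_add (Complex.I • a)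
  apply Complex.ext
  · simpa using (sub_eq_zero.1 hre_sub).symm
  · simpa using (neg_eq_of_add_eq_zero_right (him_add a)).symm

theorem IsState.add_smul {ω₁ ω₂ : WeakDual ℂ A} (h₁ : IsState ω₁) (h₂ : IsState ω₂) {s t : ℝ}
    (hs : 0 ≤ s) (ht : 0 ≤ t) (hst : s + t = 1) : IsState (s • ω₁ + t • ω₂) := by
  have happly : ∀ a, (s • ω₁ + t • ω₂ : WeakDual ℂ A) a = s * ω₁ a + t * ω₂ a := fun _ => rfl
  refine ⟨fun a => ?_, ?_⟩
  · rw [happly]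
    exact add_nonneg (mul_nonneg (by exact_mod_cast hs) (h₁.1 a))
      (mul_nonneg (by exact_mod_cast ht) (h₂.1 a))
  · rw [happly, h₁.2, h₂.2, mul_one, mul_one]
    exact_mod_cast hst

end State

section KMSCondition

variable {A : Type*} [CStarAlgebra A] {α : ℝ → A ≃⋆ₐ[ℂ] A} {β : ℝ} {ω : WeakDual ℂ A}

/-- The largest domain of the `β`-KMS condition for `ω`: the analytic elements `a`, with entire
extension `z ↦ α_z(a)`, such that `ω(α_z(a) b) = ω(b α_{z+iβ}(a))` for all `z` and all `b`. Asking
for all `z`, rather than for `z = 0` only, makes it invariant under `α`. -/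
def kmsSubalgebra (α : ℝ → A ≃⋆ₐ[ℂ] A) (β : ℝ) (hω : IsState ω) : NonUnitalStarSubalgebra ℂ A where
  carrier := {a | ∃ g, IsEntireExtension α a g ∧
    ∀ z b, ω (g z * b) = ω (b * g (z + Complex.I * β))}
  add_mem' := by
    rintro a b ⟨g, hg, hgω⟩ ⟨h, hh, hhω⟩
    refine ⟨_, hg.add hh, fun z c => ?_⟩
    rw [add_mul, mul_add, map_add, map_add, hgω, hhω]
  zero_mem' := ⟨fun _ => 0, ⟨differentiable_const _, fun t => by simp⟩, fun z b => by simp⟩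
  mul_mem' := by
    rintro a b ⟨g, hg, hgω⟩ ⟨h, hh, hhω⟩
    refine ⟨_, hg.mul hh, fun z c => ?_⟩
    rw [mul_assoc, hgω, mul_assoc, hhω, mul_assoc]
  smul_mem' := by
    rintro r a ⟨g, hg, hgω⟩
    refine ⟨_, hg.smul r, fun z c => ?_⟩
    rw [smul_mul_assoc, mul_smul_comm, map_smul, map_smul, hgω]
  star_mem' := by
    rintro a ⟨g, hg, hgω⟩
    refine ⟨_, hg.star, fun z c => ?_⟩
    have hshift : ω (g (star (z + Complex.I * β)) * star c) = ω (star c * g (star z)) := by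
      rw [hgω]; simp
    calc ω (star (g (star z)) * c) = star (ω (star c * g (star z))) := by
          rw [← hω.apply_star, star_mul, star_star]
      _ = ω (c * star (g (star (z + Complex.I * β)))) := by
          rw [← hshift, ← hω.apply_star, star_mul, star_star]

theorem IsKMSState.dense_kmsSubalgebra (hα : IsOneParameterGroup α) (hω : IsKMSState α β ω) :
    Dense (kmsSubalgebra α β hω.1 : Set A) := by
  obtain ⟨D, hD, hinv, hkms⟩ := hω.2
  refine hD.mono fun a ha => ?_
  obtain ⟨g, hg, -⟩ := hkms a ha
  refine ⟨g, hg, fun z => ?_⟩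
  have hreal : ∀ b ∈ D, ∀ t : ℝ, ω (g t * b) = ω (b * g (t + Complex.I * β)) := fun b hb t => by
    obtain ⟨k, hk, hkω⟩ := hkms _ (hinv t a ha)
    rw [hg.2, hkω b hb, hk.unique (hg.comp_real_add hα t)]
  have hentire : ∀ b ∈ D, ω (g z * b) = ω (b * g (z + Complex.I * β)) := fun b hb =>
    congrFun (eq_of_eqOn_real (differentiable_weakDual_comp ω (hg.1.mul_const b))
      (differentiable_weakDual_comp ω
        ((hg.1.comp (differentiable_id.add_const (Complex.I * β))).const_mul b)) (hreal b hb)) z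
  exact congrFun (Continuous.ext_on hD (ω.continuous.comp (continuous_const_mul _))
    (ω.continuous.comp (continuous_mul_const _)) hentire)

theorem isKMSState_iff_dense_kmsSubalgebra (hα : IsOneParameterGroup α) :
    IsKMSState α β ω ↔ ∃ hω : IsState ω, Dense (kmsSubalgebra α β hω : Set A) := by
  refine ⟨fun h => ⟨h.1, h.dense_kmsSubalgebra hα⟩, fun ⟨hω, hdense⟩ =>
    ⟨hω, kmsSubalgebra α β hω, hdense, ?_, ?_⟩⟩
  · rintro t a ⟨g, hg, hgω⟩
    exact ⟨_, hg.comp_real_add hα t, fun z b => by rw [hgω, add_assoc]⟩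
  · rintro a ⟨g, hg, hgω⟩
    refine ⟨g, hg, fun b _ => ?_⟩
    simpa only [hg.apply_zero hα, zero_add] using hgω 0 b

/-- For `β ≠ 0` the KMS condition with `b = 1` makes `z ↦ ω(α_z(a))` periodic in the imaginary
direction, hence bounded, hence constant. -/
theorem IsKMSState.apply_flow (hα : IsOneParameterGroup α) (hβ : β ≠ 0)
    (hω : IsKMSState α β ω) (t : ℝ) (a : A) : ω (α t a) = ω a := by
  refine congrFun (Continuous.ext_on (hω.dense_kmsSubalgebra hα)
    (ω.continuous.comp (StarAlgEquiv.isometry (α t)).continuous) ω.continuous ?_) a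
  rintro a ⟨g, hg, hgω⟩
  have hperiodic (s : ℝ) : Function.Periodic (fun t : ℝ => ω (g (s + t * Complex.I))) β := by
    intro t
    simpa [add_mul, add_assoc, mul_comm Complex.I] using (hgω (s + t * Complex.I) 1).symm
  obtain ⟨K, hK⟩ := hg.exists_norm_le_on_strip hα β
  have hbounded : Bornology.IsBounded (range fun z => ω (g z)) := by
    refine isBounded_iff_forall_norm_le.2 ⟨‖WeakDual.toStrongDual ω‖ * K, ?_⟩
    rintro _ ⟨z, rfl⟩
    obtain ⟨t, ht, htz⟩ : ω (g (z.re + z.im * Complex.I)) ∈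
        (fun t : ℝ => ω (g (z.re + t * Complex.I))) '' uIcc 0 β := by
      rw [← zero_add β, (hperiodic z.re).image_uIcc hβ 0]
      exact mem_range_self z.im
    rw [Complex.re_add_im] at htz
    refine (congrArg norm htz.symm).le.trans ?_
    exact (WeakDual.toStrongDual ω).le_of_opNorm_le_of_le le_rfl (hK _ t ht)
  calc ω (α t a) = ω (g t) := by rw [hg.2]
    _ = ω (g 0) :=
      (differentiable_weakDual_comp ω hg.1).apply_eq_apply_of_bounded hbounded _ _
    _ = ω a := by rw [hg.apply_zero hα]

theorem IsKMSState.apply_entireExtension (hα : IsOneParameterGroup α) (hβ : β ≠ 0)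
    (hω : IsKMSState α β ω) {a : A} {g : ℂ → A} (hg : IsEntireExtension α a g) (z : ℂ) :
    ω (g z) = ω a :=
  congrFun (eq_of_eqOn_real (differentiable_weakDual_comp ω hg.1) (differentiable_const (ω a))
    fun t => by rw [hg.2, hω.apply_flow hα hβ]) z

theorem IsKMSState.apply_mul (hα : IsOneParameterGroup α) (hω : IsKMSState α β ω) {a : A}
    {g : ℂ → A} (hg : IsEntireExtension α a g) (b : A) :
    ω (a * b) = ω (b * g (Complex.I * β)) := by
  refine congrFun (Continuous.ext_on (hω.dense_kmsSubalgebra hα)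
    (ω.continuous.comp (continuous_const_mul a)) (ω.continuous.comp (continuous_mul_const _)) ?_) b
  rintro b ⟨h, hh, hhω⟩
  have hkms (c : A) : ω (b * c) = ω (c * h (Complex.I * β)) := by
    simpa only [hh.apply_zero hα, zero_add] using hhω 0 c
  change ω (a * b) = ω (b * g (Complex.I * β))
  rcases eq_or_ne β 0 with rfl | hβ
  · rw [hkms, Complex.ofReal_zero, mul_zero, hg.apply_zero hα, hh.apply_zero hα]
  · rw [hkms, hω.apply_entireExtension hα hβ (hg.mul hh)]

theorem convex_kmsStates (hα : IsOneParameterGroup α) (β : ℝ) : Convex ℝ (kmsStates α β) := by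
  intro ω₁ h₁ ω₂ h₂ s t hs ht hst
  have happly : ∀ a, (s • ω₁ + t • ω₂ : WeakDual ℂ A) a = s * ω₁ a + t * ω₂ a := fun _ => rfl
  obtain ⟨D, hD, hinv, hkms⟩ := h₁.2
  refine ⟨h₁.1.add_smul h₂.1 hs ht hst, D, hD, hinv, fun a ha => ?_⟩
  obtain ⟨g, hg, -⟩ := hkms a ha
  exact ⟨g, hg, fun b _ => by rw [happly, happly, h₁.apply_mul hα hg, h₂.apply_mul hα hg]⟩

end KMSCondition

namespace CrossedProduct

section Phase

variable {X : Type*} [TopologicalSpace X] (F : C(X, ℝ))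

theorem phase_add (s t : ℝ) : phase F (s + t) = phase F s * phase F t := by
  ext x
  change Complex.exp _ = Complex.exp _ * Complex.exp _
  rw [← Complex.exp_add]
  push_cast
  ring_nf

/-- The function `e^{-izF}` for complex `z`, extending `phase F` from the real line. -/
def complexPhase (z : ℂ) : C(X, ℂ) :=
  ⟨fun x => Complex.exp (-(Complex.I * z * F x)), by fun_prop⟩

theorem complexPhase_add (z w : ℂ) :
    complexPhase F (z + w) = complexPhase F z * complexPhase F w := by
  ext x
  change Complex.exp _ = Complex.exp _ * Complex.exp _
  rw [← Complex.exp_add]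
  ring_nf

theorem complexPhase_I_mul_apply (β : ℝ) (x : X) :
    complexPhase F (Complex.I * β) x = Real.exp (β * F x) := by
  change Complex.exp (-(Complex.I * (Complex.I * β) * F x)) = _
  rw [← mul_assoc Complex.I, Complex.I_mul_I]
  push_cast
  ring_nf

theorem differentiable_complexPhase [CompactSpace X] : Differentiable ℂ (complexPhase F) := by
  let G : C(X, ℂ) := ⟨fun x => F x, by fun_prop⟩
  have hexp : complexPhase F = fun z => NormedSpace.exp ((-(Complex.I * z)) • G) := by
    funext z
    ext x
    refine Eq.trans ?_ (NormedSpace.map_exp (ContinuousMap.evalAlgHom ℂ ℂ x)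
      (ContinuousEvalConst.continuous_eval_const x) _).symm
    rw [← Complex.exp_eq_exp_ℂ]
    exact congrArg Complex.exp (neg_mul _ _).symm
  have hdiff : Differentiable ℂ (NormedSpace.exp : C(X, ℂ) → C(X, ℂ)) := fun f =>
    (NormedSpace.exp_analytic f).differentiableAt
  rw [hexp]
  exact hdiff.comp (by fun_prop)

end Phase

variable {X : Type u} [TopologicalSpace X] [CompactSpace X] {φ : X ≃ₜ X}

section Flow

variable (φ) (F : C(X, ℝ))

theorem isOneParameterGroup_flow : IsOneParameterGroup (flow φ F) := fun s t a => by
  change twist φ (phase F (s + t)) a = _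
  rw [phase_add, ← twist_twist]
  rfl

theorem isEntireExtension_ι (f : C(X, ℂ)) :
    IsEntireExtension (flow φ F) (ι φ f) fun _ => ι φ f :=
  ⟨differentiable_const _, fun t => (flow_ι F t f).symm⟩

theorem isEntireExtension_U :
    IsEntireExtension (flow φ F) (U φ : CrossedProduct φ)
      fun z => (U φ : CrossedProduct φ) * ι φ (complexPhase F z) :=
  ⟨(differentiable_starAlgHom_comp (ι φ) (differentiable_complexPhase F)).const_mul _,
    fun _ => rfl⟩

end Flow

section Monomial

/-- The element `f Uⁿ` of the crossed product. -/
def monomial (φ : X ≃ₜ X) (f : C(X, ℂ)) (n : ℤ) : CrossedProduct φ :=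
  ι φ f * ((U φ ^ n : unitary (CrossedProduct φ)) : CrossedProduct φ)

theorem monomial_zero (f : C(X, ℂ)) : monomial φ f 0 = ι φ f := by
  rw [monomial, zpow_zero, OneMemClass.coe_one, mul_one]

theorem monomial_one_one : monomial φ 1 1 = (U φ : CrossedProduct φ) := by
  rw [monomial, map_one, one_mul, zpow_one]

theorem U_mul_ι (f : C(X, ℂ)) :
    (U φ : CrossedProduct φ) * ι φ f =
      ι φ (f.comp (φ.symm : C(X, X))) * (U φ : CrossedProduct φ) := by
  rw [← U_mul_ι_mul_star, mul_assoc _ (star _), Unitary.coe_star_mul_self, mul_one]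

theorem U_inv_mul_ι (f : C(X, ℂ)) :
    ((U φ)⁻¹ : unitary (CrossedProduct φ)) * ι φ f =
      ι φ (f.comp (φ : C(X, X))) * ((U φ)⁻¹ : unitary (CrossedProduct φ)) := by
  have hcomp : (f.comp (φ : C(X, X))).comp (φ.symm : C(X, X)) = f := by ext x; simp
  change star (U φ : CrossedProduct φ) * ι φ f = _ * star (U φ : CrossedProduct φ)
  calc star (U φ : CrossedProduct φ) * ι φ f
      = star (U φ : CrossedProduct φ) * ((U φ : CrossedProduct φ) *
          ι φ (f.comp (φ : C(X, X))) * star (U φ : CrossedProduct φ)) := by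
        rw [U_mul_ι_mul_star, hcomp]
    _ = ι φ (f.comp (φ : C(X, X))) * star (U φ : CrossedProduct φ) := by
        rw [← mul_assoc, ← mul_assoc, Unitary.coe_star_mul_self, one_mul]

theorem U_zpow_mul_ι (n : ℤ) (f : C(X, ℂ)) :
    ((U φ ^ n : unitary (CrossedProduct φ)) : CrossedProduct φ) * ι φ f =
      monomial φ (f.comp ((φ ^ n).symm : C(X, X))) n := by
  rw [monomial]
  induction n generalizing f with
  | zero =>
    rw [zpow_zero, OneMemClass.coe_one, one_mul, mul_one]
    rfl
  | succ n ih =>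
    rw [zpow_add_one, Submonoid.coe_mul, mul_assoc, U_mul_ι, ← mul_assoc, ih, mul_assoc,
      zpow_add_one]
    rfl
  | pred n ih =>
    rw [zpow_sub_one, Submonoid.coe_mul, mul_assoc, U_inv_mul_ι, ← mul_assoc, ih, mul_assoc,
      zpow_sub_one]
    rfl

theorem monomial_mul_monomial (f g : C(X, ℂ)) (m n : ℤ) :
    monomial φ f m * monomial φ g n =
      monomial φ (f * g.comp ((φ ^ m).symm : C(X, X))) (m + n) := by
  have hmn : ((U φ ^ m : unitary (CrossedProduct φ)) : CrossedProduct φ) *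
      (U φ ^ n : unitary (CrossedProduct φ)) = (U φ ^ (m + n) : unitary (CrossedProduct φ)) := by
    rw [zpow_add, Submonoid.coe_mul]
  calc monomial φ f m * monomial φ g n
      = ι φ f * (((U φ ^ m : unitary (CrossedProduct φ)) : CrossedProduct φ) * ι φ g) *
          (U φ ^ n : unitary (CrossedProduct φ)) := by simp only [monomial, mul_assoc]
    _ = _ := by simp only [U_zpow_mul_ι, monomial, map_mul, mul_assoc, hmn]

theorem E_monomial (f : C(X, ℂ)) (n : ℤ) : E φ (monomial φ f n) = if n = 0 then f else 0 :=
  E_ι_mul_U_zpow f n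

theorem dense_span_monomial :
    Dense (Submodule.span ℂ (range fun p : C(X, ℂ) × ℤ => monomial φ p.1 p.2) :
      Set (CrossedProduct φ)) := by
  set S := Submodule.span ℂ (range fun p : C(X, ℂ) × ℤ => monomial φ p.1 p.2) with hS
  have hmem (f : C(X, ℂ)) (n : ℤ) : monomial φ f n ∈ (S : Set (CrossedProduct φ)) :=
    Submodule.subset_span ⟨(f, n), rfl⟩
  have hmul : ∀ a ∈ S, ∀ b ∈ S, a * b ∈ S := fun a ha b hb => by
    have hab := Submodule.mul_mem_mul ha hb
    rw [hS, Submodule.span_mul_span] at hab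
    refine Submodule.span_le.2 ?_ hab
    rintro _ ⟨_, ⟨⟨f, m⟩, rfl⟩, _, ⟨⟨g, n⟩, rfl⟩, rfl⟩
    simpa only [monomial_mul_monomial] using hmem _ _
  intro a
  refine closed_induction (p := fun a => a ∈ closure (S : Set (CrossedProduct φ)))
    isClosed_closure (fun f => subset_closure ?_) (subset_closure ?_) (subset_closure ?_)
    (fun a b ha hb => ?_) (fun a b ha hb => ?_) a
  · simpa only [monomial_zero] using hmem f 0
  · simpa only [monomial_one_one] using hmem 1 1
  · have hinv := hmem 1 (-1)
    rwa [monomial, map_one, one_mul, zpow_neg_one] at hinv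
  · exact map_mem_closure₂ continuous_add ha hb fun _ hc _ hd => S.add_mem hc hd
  · exact map_mem_closure₂ continuous_mul ha hb fun _ hc _ hd => hmul _ hc _ hd

theorem clm_ext_monomial {V : Type*} [AddCommMonoid V] [Module ℂ V] [TopologicalSpace V] [T2Space V]
    {S T : CrossedProduct φ →L[ℂ] V} (h : ∀ f n, S (monomial φ f n) = T (monomial φ f n)) :
    S = T :=
  ContinuousLinearMap.ext_on dense_span_monomial <| by
    rintro _ ⟨⟨f, n⟩, rfl⟩
    exact h f n

end Monomial

section Expectation

theorem E_apply (a : CrossedProduct φ) (x : X) :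
    E φ a x = reg φ x a (basisVec 0) (⟨0⟩ : ULift.{u} ℤ) := rfl

theorem E_ι_mul (f : C(X, ℂ)) (a : CrossedProduct φ) : E φ (ι φ f * a) = f * E φ a := by
  ext x
  rw [E_apply, map_mul, mul_apply_eq_comp, reg_ι_apply]
  rfl

theorem E_mul_ι (f : C(X, ℂ)) (a : CrossedProduct φ) : E φ (a * ι φ f) = E φ a * f := by
  ext x
  rw [E_apply, map_mul, mul_apply_eq_comp, reg_ι_basisVec, map_smul]
  exact mul_comm _ _

theorem E_ι (f : C(X, ℂ)) : E φ (ι φ f) = f := by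
  rw [← monomial_zero, E_monomial, if_pos rfl]

theorem ellTwo_apply_zero (ξ : ellTwo.{u}) :
    ξ (⟨0⟩ : ULift.{u} ℤ) = inner ℂ (basisVec 0) ξ := by
  rw [basisVec, lp.inner_single_left, RCLike.inner_apply, map_one, mul_one]

theorem E_star_mul_self_nonneg (a : CrossedProduct φ) : 0 ≤ E φ (star a * a) := fun x => by
  change 0 ≤ E φ (star a * a) x
  rw [E_apply, ellTwo_apply_zero, map_mul, map_star, ContinuousLinearMap.star_eq_adjoint,
    mul_apply_eq_comp, ContinuousLinearMap.adjoint_inner_right, inner_self_eq_norm_sq_to_K]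
  exact pow_nonneg (Complex.zero_le_real.2 (norm_nonneg (reg φ x a (basisVec 0)))) 2

theorem norm_E_le (a : CrossedProduct φ) : ‖E φ a‖ ≤ ‖a‖ := by
  have hbasis : ‖basisVec.{u} 0‖ = 1 := by rw [basisVec, lp.norm_single two_pos, norm_one]
  refine (ContinuousMap.norm_le _ (norm_nonneg a)).2 fun x => ?_
  calc ‖E φ a x‖ ≤ ‖reg φ x a (basisVec 0)‖ := lp.norm_apply_le_norm two_ne_zero _ _
    _ ≤ ‖a‖ * ‖basisVec.{u} 0‖ := norm_reg_apply_le x a _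
    _ = ‖a‖ := by rw [hbasis, mul_one]

/-- The conditional expectation `E φ` as a continuous linear map. -/
def expectation (φ : X ≃ₜ X) : CrossedProduct φ →L[ℂ] C(X, ℂ) :=
  (E φ).mkContinuous 1 fun a => (norm_E_le a).trans_eq (one_mul _).symm

theorem expectation_apply (a : CrossedProduct φ) : expectation φ a = E φ a := rfl

theorem expectation_U_mul (a : CrossedProduct φ) :
    expectation φ ((U φ : CrossedProduct φ) * a) =
      (expectation φ (a * (U φ : CrossedProduct φ))).comp (φ.symm : C(X, X)) := by
  let mulLeft := ContinuousLinearMap.mul ℂ (CrossedProduct φ) (U φ : CrossedProduct φ)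
  let mulRight := (ContinuousLinearMap.mul ℂ (CrossedProduct φ)).flip (U φ : CrossedProduct φ)
  let compSymm := ContinuousMap.compCLM ℂ ℂ (φ.symm : C(X, X))
  suffices expectation φ ∘L mulLeft = compSymm ∘L expectation φ ∘L mulRight from
    DFunLike.congr_fun this a
  refine clm_ext_monomial fun f n => ?_
  change E φ ((U φ : CrossedProduct φ) * monomial φ f n) =
    (E φ (monomial φ f n * (U φ : CrossedProduct φ))).comp (φ.symm : C(X, X))
  rw [← monomial_one_one, monomial_mul_monomial, monomial_mul_monomial, E_monomial, E_monomial,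
    add_comm]
  split_ifs
  · ext x
    simp
  · rfl

end Expectation

end CrossedProduct

section Riesz

variable {X : Type*} [TopologicalSpace X] [CompactSpace X]

theorem weakDual_ext_real {σ τ : WeakDual ℂ C(X, ℂ)}
    (h : ∀ f : C(X, ℝ), σ (f.realToRCLike ℂ) = τ (f.realToRCLike ℂ)) : σ = τ := by
  have hsa (f : C(X, ℂ)) (hf : IsSelfAdjoint f) : σ f = τ f := by
    rw [← ContinuousMap.IsSelfAdjoint.realToRCLike_rclikeToReal hf, h]
  refine DFunLike.ext _ _ fun f => ?_
  rw [← realPart_add_I_smul_imaginaryPart f, map_add, map_add, map_smul, map_smul,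
    hsa _ (realPart f).2, hsa _ (imaginaryPart f).2]

theorem IsState.apply_realToRCLike_nonneg {τ : WeakDual ℂ C(X, ℂ)} (hτ : IsState τ) {f : C(X, ℝ)}
    (hf : 0 ≤ f) : 0 ≤ τ (f.realToRCLike ℂ) := by
  have hf' : 0 ≤ f.realToRCLike ℂ := fun x => by simpa using hf x
  obtain ⟨g, hg⟩ := CStarAlgebra.nonneg_iff_eq_star_mul_self.1 hf'
  exact hg ▸ hτ.1 g

theorem IsState.ofReal_re_apply_realToRCLike {τ : WeakDual ℂ C(X, ℂ)} (hτ : IsState τ)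
    (f : C(X, ℝ)) : ((τ (f.realToRCLike ℂ)).re : ℂ) = τ (f.realToRCLike ℂ) := by
  refine Complex.conj_eq_iff_re.1 ?_
  rw [← Complex.star_def, ← hτ.apply_star, ← ContinuousMap.realToRCLike_star, star_trivial]

/-- The restriction of a state on `C(X)` to the real-valued functions, in the form required by the
Riesz–Markov–Kakutani theorem. -/
def realRestriction {τ : WeakDual ℂ C(X, ℂ)} (hτ : IsState τ) :
    CompactlySupportedContinuousMap X ℝ →ₚ[ℝ] ℝ :=
  PositiveLinearMap.mk₀
    { toFun := fun f => (τ (f.toContinuousMap.realToRCLike ℂ)).re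
      map_add' := fun f g => by
        rw [← Complex.add_re, ← map_add]
        exact congrArg (fun f => (τ f).re)
          (map_add (ContinuousMap.realToRCLikeStarAlgHom X ℂ) f.toContinuousMap g.toContinuousMap)
      map_smul' := fun r f => by
        have hsmul : (r • f).toContinuousMap.realToRCLike ℂ =
            (r : ℂ) • f.toContinuousMap.realToRCLike ℂ := by ext x; simp
        rw [hsmul, map_smul, smul_eq_mul, Complex.re_ofReal_mul]
        rfl }
    fun _ hf => (Complex.nonneg_iff.1 (hτ.apply_realToRCLike_nonneg hf)).1

variable [MeasurableSpace X]

theorem integrable_continuousMap [OpensMeasurableSpace X] {E : Type*} [NormedAddCommGroup E]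
    [SecondCountableTopologyEither X E] (μ : Measure X) [IsFiniteMeasure μ] (f : C(X, E)) :
    Integrable f μ :=
  .of_bound f.continuous.aestronglyMeasurable ‖f‖ (ae_of_all _ f.norm_coe_le_norm)

/-- Integration against a finite measure, as a functional on `C(X)`. -/
def integralFunctional [OpensMeasurableSpace X] (μ : Measure X) [IsFiniteMeasure μ] :
    WeakDual ℂ C(X, ℂ) :=
  StrongDual.toWeakDual <| LinearMap.mkContinuous
    { toFun := fun f => ∫ x, f x ∂μ
      map_add' := fun f g =>
        integral_add (integrable_continuousMap μ f) (integrable_continuousMap μ g)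
      map_smul' := fun r f => integral_smul r f } (μ.real univ) fun f => by
    rw [mul_comm]
    exact norm_integral_le_of_norm_le_const (ae_of_all _ f.norm_coe_le_norm)

theorem integralFunctional_apply [OpensMeasurableSpace X] (μ : Measure X) [IsFiniteMeasure μ]
    (f : C(X, ℂ)) : integralFunctional μ f = ∫ x, f x ∂μ := rfl

theorem integralFunctional_realToRCLike [OpensMeasurableSpace X] (μ : Measure X)
    [IsFiniteMeasure μ] (f : C(X, ℝ)) :
    integralFunctional μ (f.realToRCLike ℂ) = ((∫ x, f x ∂μ : ℝ) : ℂ) :=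
  integral_ofReal

variable [BorelSpace X]

theorem integralFunctional_injective [HasOuterApproxClosed X] {μ ν : Measure X}
    [IsFiniteMeasure μ] [IsFiniteMeasure ν] (h : integralFunctional μ = integralFunctional ν) :
    μ = ν := by
  refine ext_of_forall_integral_eq_of_IsFiniteMeasure fun f => ?_
  have hf := DFunLike.congr_fun h (f.toContinuousMap.realToRCLike ℂ)
  rw [integralFunctional_realToRCLike, integralFunctional_realToRCLike] at hf
  exact Complex.ofReal_injective hf

theorem IsState.exists_probabilityMeasure [T2Space X] {τ : WeakDual ℂ C(X, ℂ)} (hτ : IsState τ) :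
    ∃ m : ProbabilityMeasure X, τ = integralFunctional (m : Measure X) := by
  set μ := RealRMK.rieszMeasure (realRestriction hτ)
  have hμ : τ = integralFunctional μ := weakDual_ext_real fun f => by
    have hriesz : ∫ x, f x ∂μ = (τ (f.realToRCLike ℂ)).re :=
      RealRMK.integral_rieszMeasure (realRestriction hτ)
        (CompactlySupportedContinuousMap.continuousMapEquiv f)
    rw [integralFunctional_realToRCLike, hriesz, hτ.ofReal_re_apply_realToRCLike]
  have hprob : IsProbabilityMeasure μ := by
    have hone := hτ.2
    rw [hμ, integralFunctional_apply] at hone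
    simpa [isProbabilityMeasure_iff_real] using hone
  exact ⟨⟨μ, hprob⟩, hμ⟩

end Riesz

section Conformal

variable {X : Type*} [TopologicalSpace X] [MeasurableSpace X] [BorelSpace X] {φ : X ≃ₜ X}
  {F : C(X, ℝ)} {β : ℝ} {m : ProbabilityMeasure X}

theorem mem_conformalMeasures_iff_map_eq :
    m ∈ conformalMeasures φ F β ↔ (m : Measure X).map φ.symm =
      (m : Measure X).withDensity fun x => ENNReal.ofReal (Real.exp (β * F x)) := by
  rw [Measure.ext_iff]
  refine forall₂_congr fun B hB => ?_
  rw [Measure.map_apply φ.symm.measurable hB, withDensity_apply _ hB, φ.image_eq_preimage_symm]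

theorem mem_conformalMeasures_iff_integral_eq [CompactSpace X] [HasOuterApproxClosed X] :
    m ∈ conformalMeasures φ F β ↔ ∀ f : C(X, ℂ), ∫ x, f (φ.symm x) ∂(m : Measure X) =
      ∫ x, (Real.exp (β * F x) : ℂ) * f x ∂(m : Measure X) := by
  set ν := (m : Measure X).withDensity fun x => ENNReal.ofReal (Real.exp (β * F x))
  have hcont : Continuous fun x => Real.exp (β * F x) := by fun_prop
  have hν : IsFiniteMeasure ν :=
    isFiniteMeasure_withDensity_ofReal (integrable_continuousMap _ ⟨_, hcont⟩).2
  have hmap (f : C(X, ℂ)) : integralFunctional ((m : Measure X).map φ.symm) f =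
      ∫ x, f (φ.symm x) ∂(m : Measure X) := φ.symm.measurableEmbedding.integral_map _
  have hdensity (f : C(X, ℂ)) :
      integralFunctional ν f = ∫ x, (Real.exp (β * F x) : ℂ) * f x ∂(m : Measure X) := by
    rw [integralFunctional_apply, integral_withDensity_eq_integral_toReal_smul
      hcont.measurable.ennreal_ofReal (ae_of_all _ fun _ => ENNReal.ofReal_lt_top)]
    simp only [ENNReal.toReal_ofReal (Real.exp_nonneg _), Complex.real_smul]
  rw [mem_conformalMeasures_iff_map_eq]
  refine ⟨fun h f => ?_, fun h => integralFunctional_injective (DFunLike.ext _ _ fun f => ?_)⟩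
  · rw [← hmap, ← hdensity]
    congr
  · rw [hmap, hdensity, h]

end Conformal

section Free

/-- All nonzero powers of `φ` are fixed-point free, i.e. the `ℤ`-action generated by `φ` is free. -/
def IsFreeHomeo {X : Type*} [TopologicalSpace X] (φ : X ≃ₜ X) : Prop :=
  ∀ n : ℤ, n ≠ 0 → ∀ x, (φ ^ n) x ≠ x

theorem IsMinimalHomeo.isFreeHomeo {X : Type*} [TopologicalSpace X] [T1Space X] [Infinite X]
    {φ : X ≃ₜ X} (hφ : IsMinimalHomeo φ) : IsFreeHomeo φ := by
  intro n hn x hx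
  have hperiod (k : ℤ) : (φ ^ k) x = (φ ^ (k % n)) x := by
    have hfix : ((φ ^ n) ^ (k / n)) x = x :=
      zpow_induction_right (P := fun ψ : X ≃ₜ X => ψ x = x) rfl
        (fun ψ hψ => (congrArg ψ hx).trans hψ)
        (fun ψ hψ => (congrArg ψ ((φ ^ n).symm_apply_eq.2 hx.symm)).trans hψ) _
    conv_lhs => rw [← Int.emod_add_mul_ediv k n, zpow_add, zpow_mul]
    exact congrArg (φ ^ (k % n)) hfix
  have hfinite : (range fun k : ℤ => (φ ^ k) x).Finite := by
    refine ((finite_Ico 0 |n|).image fun k : ℤ => (φ ^ k) x).subset ?_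
    rintro _ ⟨k, rfl⟩
    exact ⟨k % n, ⟨Int.emod_nonneg k hn, Int.emod_lt_abs k hn⟩, (hperiod k).symm⟩
  have huniv : (range fun k : ℤ => (φ ^ k) x) = univ := by
    rw [← hfinite.isClosed.closure_eq]
    exact (hφ x).closure_eq
  exact infinite_univ (huniv ▸ hfinite)

theorem span_comp_sub_eq_top {X : Type*} [TopologicalSpace X] [CompactSpace X] [T2Space X]
    {ψ : C(X, X)} (hψ : ∀ x, ψ x ≠ x) :
    Ideal.span (range fun g : C(X, ℂ) => g.comp ψ - g) = ⊤ := by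
  by_contra hne
  obtain ⟨M, hM, hle⟩ := Ideal.exists_le_maximal _ hne
  obtain ⟨x, hx⟩ := ContinuousMap.setOfIdeal_eq_compl_singleton M
  have hvanish (g : C(X, ℂ)) : g (ψ x) = g x :=
    sub_eq_zero.1 <| ContinuousMap.notMem_setOfIdeal.1 (by rw [hx]; simp)
      (hle (Ideal.subset_span ⟨g, rfl⟩))
  obtain ⟨g, hgx, hgψ, -⟩ := exists_continuous_zero_one_of_isClosed (isClosed_singleton (x := x))
    (isClosed_singleton (x := ψ x)) (disjoint_singleton.2 (hψ x).symm)
  have hg := hvanish (g.realToRCLike ℂ)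
  simp [hgx (mem_singleton x), hgψ (mem_singleton (ψ x))] at hg

end Free

section KMSState

open CrossedProduct

variable {X : Type u} [TopologicalSpace X] [CompactSpace X] {φ : X ≃ₜ X} {F : C(X, ℝ)} {β : ℝ}
  {ω : WeakDual ℂ (CrossedProduct φ)}

/-- The flow fixes `g ∈ C(X)`, so the KMS condition lets `g` be cycled past `h Uⁿ`. -/
theorem IsKMSState.apply_monomial_mul_comp_sub (hω : IsKMSState (flow φ F) β ω) (n : ℤ)
    (g h : C(X, ℂ)) :
    ω (monomial φ (h * (g.comp ((φ ^ n).symm : C(X, X)) - g)) n) = 0 := by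
  have hcycle := hω.apply_mul (isOneParameterGroup_flow φ F) (isEntireExtension_ι φ F g)
    (monomial φ h n)
  rw [monomial, mul_assoc, U_zpow_mul_ι, monomial, ← mul_assoc, ← mul_assoc, ← map_mul,
    ← map_mul] at hcycle
  rw [monomial, mul_sub, map_sub, sub_mul, map_sub, ← hcycle, mul_comm g h, sub_self]

theorem IsKMSState.apply_monomial_of_ne_zero [T2Space X] (hφ : IsFreeHomeo φ)
    (hω : IsKMSState (flow φ F) β ω) {n : ℤ} (hn : n ≠ 0) (f : C(X, ℂ)) :
    ω (monomial φ f n) = 0 := by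
  have hfix (x : X) : ((φ ^ n).symm : C(X, X)) x ≠ x := fun hx =>
    hφ n hn x ((φ ^ n).symm_apply_eq.1 hx).symm
  let S : Ideal C(X, ℂ) :=
    { carrier := {f | ∀ h, ω (monomial φ (h * f) n) = 0}
      zero_mem' := fun h => by simp only [monomial, mul_zero, map_zero, zero_mul]
      add_mem' := fun hf hg h => by
        have := congrArg₂ (· + ·) (hf h) (hg h)
        simpa only [monomial, mul_add, map_add, add_mul, add_zero] using this
      smul_mem' := fun r f hf h => by rw [smul_eq_mul, ← mul_assoc]; exact hf (h * r) }
  have htop : S = ⊤ := by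
    rw [eq_top_iff, ← span_comp_sub_eq_top hfix, Ideal.span_le]
    rintro _ ⟨g, rfl⟩
    exact hω.apply_monomial_mul_comp_sub n g
  have hf : f ∈ S := htop ▸ Submodule.mem_top
  simpa only [one_mul] using hf 1

end KMSState

section Restriction

variable {A B : Type*} [CStarAlgebra A] [CStarAlgebra B]

/-- The pullback `ω ∘ π` of a functional along a `⋆`-homomorphism. -/
def weakDualComp (ω : WeakDual ℂ B) (π : A →⋆ₐ[ℂ] B) : WeakDual ℂ A :=
  StrongDual.toWeakDual
    ((WeakDual.toStrongDual ω).comp ⟨π.toAlgHom.toLinearMap, map_continuous π⟩)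

theorem weakDualComp_apply (ω : WeakDual ℂ B) (π : A →⋆ₐ[ℂ] B) (a : A) :
    weakDualComp ω π a = ω (π a) := rfl

theorem IsState.weakDualComp {ω : WeakDual ℂ B} (hω : IsState ω) (π : A →⋆ₐ[ℂ] B) :
    IsState (weakDualComp ω π) := by
  refine ⟨fun a => ?_, ?_⟩
  · rw [weakDualComp_apply, map_mul, map_star]
    exact hω.1 _
  · rw [weakDualComp_apply, map_one, hω.2]

end Restriction

section ConformalState

open CrossedProduct

variable {X : Type u} [TopologicalSpace X] [CompactSpace X] [MeasurableSpace X] {φ : X ≃ₜ X}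

/-- The functional `a ↦ ∫ E(a) dm` on the crossed product. -/
def stateOfMeasure [OpensMeasurableSpace X] (φ : X ≃ₜ X) (m : ProbabilityMeasure X) :
    WeakDual ℂ (CrossedProduct φ) :=
  StrongDual.toWeakDual
    ((WeakDual.toStrongDual (integralFunctional (m : Measure X))).comp (expectation φ))

theorem stateOfMeasure_apply [OpensMeasurableSpace X] (m : ProbabilityMeasure X)
    (a : CrossedProduct φ) : stateOfMeasure φ m a = ∫ x, E φ a x ∂(m : Measure X) := rfl

theorem stateOfMeasure_ι [OpensMeasurableSpace X] (m : ProbabilityMeasure X) (f : C(X, ℂ)) :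
    stateOfMeasure φ m (ι φ f) = ∫ x, f x ∂(m : Measure X) := by
  rw [stateOfMeasure_apply, E_ι]

theorem isState_stateOfMeasure [OpensMeasurableSpace X] (m : ProbabilityMeasure X) :
    IsState (stateOfMeasure φ m) := by
  refine ⟨fun a => integral_nonneg (E_star_mul_self_nonneg a), ?_⟩
  rw [← map_one (ι φ), stateOfMeasure_ι]
  simp

theorem stateOfMeasure_ι_mul [OpensMeasurableSpace X] (m : ProbabilityMeasure X) (f : C(X, ℂ))
    (b : CrossedProduct φ) : stateOfMeasure φ m (ι φ f * b) = stateOfMeasure φ m (b * ι φ f) := by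
  rw [stateOfMeasure_apply, stateOfMeasure_apply, E_ι_mul, E_mul_ι, mul_comm]

theorem continuous_stateOfMeasure [OpensMeasurableSpace X] : Continuous (stateOfMeasure φ) :=
  WeakDual.continuous_of_continuous_eval fun a => continuous_iff_continuousAt.2 fun _ =>
    (ProbabilityMeasure.tendsto_iff_forall_integral_rclike_tendsto ℂ).1 tendsto_id
      (BoundedContinuousFunction.mkOfCompact (E φ a))

variable [BorelSpace X] {F : C(X, ℝ)} {β : ℝ}

section HasOuterApproxClosed

variable [HasOuterApproxClosed X]

theorem stateOfMeasure_U_mul {m : ProbabilityMeasure X} (hm : m ∈ conformalMeasures φ F β)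
    (b : CrossedProduct φ) :
    stateOfMeasure φ m ((U φ : CrossedProduct φ) * b) =
      stateOfMeasure φ m (b * ((U φ : CrossedProduct φ) * ι φ (complexPhase F (Complex.I * β)))) :=
  calc stateOfMeasure φ m ((U φ : CrossedProduct φ) * b)
      = ∫ x, E φ (b * (U φ : CrossedProduct φ)) (φ.symm x) ∂(m : Measure X) := by
        rw [stateOfMeasure_apply, ← expectation_apply, expectation_U_mul]
        rfl
    _ = ∫ x, (Real.exp (β * F x) : ℂ) * E φ (b * (U φ : CrossedProduct φ)) x ∂(m : Measure X) :=
        mem_conformalMeasures_iff_integral_eq.1 hm _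
    _ = stateOfMeasure φ m
          (b * ((U φ : CrossedProduct φ) * ι φ (complexPhase F (Complex.I * β)))) := by
        rw [← mul_assoc, ← stateOfMeasure_ι_mul, stateOfMeasure_apply, E_ι_mul]
        simp only [ContinuousMap.mul_apply, complexPhase_I_mul_apply]

theorem isKMSState_stateOfMeasure {m : ProbabilityMeasure X} (hm : m ∈ conformalMeasures φ F β) :
    IsKMSState (flow φ F) β (stateOfMeasure φ m) := by
  refine (isKMSState_iff_dense_kmsSubalgebra (isOneParameterGroup_flow φ F)).2
    ⟨isState_stateOfMeasure m, ?_⟩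
  set D := kmsSubalgebra (flow φ F) β (isState_stateOfMeasure m)
  have hι (f : C(X, ℂ)) : ι φ f ∈ D :=
    ⟨_, isEntireExtension_ι φ F f, fun _ b => stateOfMeasure_ι_mul m f b⟩
  have hU : (U φ : CrossedProduct φ) ∈ D := by
    refine ⟨_, isEntireExtension_U φ F, fun z b => ?_⟩
    have hphase : ι φ (complexPhase F (z + Complex.I * β)) =
        ι φ (complexPhase F (Complex.I * β)) * ι φ (complexPhase F z) := by
      rw [add_comm, complexPhase_add, map_mul]
    rw [mul_assoc, stateOfMeasure_U_mul hm, mul_assoc, stateOfMeasure_ι_mul, hphase]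
    simp only [mul_assoc]
  intro a
  refine closed_induction (p := fun a => a ∈ closure (D : Set (CrossedProduct φ)))
    isClosed_closure (fun f => subset_closure (hι f)) (subset_closure hU)
    (subset_closure (star_mem hU)) (fun a b ha hb => ?_) (fun a b ha hb => ?_) a
  · exact map_mem_closure₂ continuous_add ha hb fun _ hc _ hd => add_mem hc hd
  · exact map_mem_closure₂ continuous_mul ha hb fun _ hc _ hd => mul_mem hc hd

end HasOuterApproxClosed

section T2Space

variable [T2Space X] {ω : WeakDual ℂ (CrossedProduct φ)}

theorem IsKMSState.eq_stateOfMeasure (hφ : IsFreeHomeo φ) (hω : IsKMSState (flow φ F) β ω)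
    {m : ProbabilityMeasure X} (hm : ∀ f, ω (ι φ f) = ∫ x, f x ∂(m : Measure X)) :
    ω = stateOfMeasure φ m := by
  refine WeakDual.toStrongDual.injective (clm_ext_monomial fun f n => ?_)
  change ω (monomial φ f n) = stateOfMeasure φ m (monomial φ f n)
  rcases eq_or_ne n 0 with rfl | hn
  · rw [monomial_zero, hm, stateOfMeasure_ι]
  · rw [hω.apply_monomial_of_ne_zero hφ hn, stateOfMeasure_apply, E_monomial, if_neg hn]
    exact (integral_zero _ _).symm

theorem IsKMSState.exists_conformalMeasure [HasOuterApproxClosed X]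
    (hω : IsKMSState (flow φ F) β ω) :
    ∃ m ∈ conformalMeasures φ F β, ∀ f, ω (ι φ f) = ∫ x, f x ∂(m : Measure X) := by
  obtain ⟨m, hm⟩ := (hω.1.weakDualComp (ι φ)).exists_probabilityMeasure
  have hm' : ∀ f, ω (ι φ f) = ∫ x, f x ∂(m : Measure X) := DFunLike.congr_fun hm
  refine ⟨m, mem_conformalMeasures_iff_integral_eq.2 fun f => ?_, hm'⟩
  have hU : ω (ι φ (f.comp (φ.symm : C(X, X)))) = ω (ι φ (complexPhase F (Complex.I * β) * f)) :=
    calc ω (ι φ (f.comp (φ.symm : C(X, X))))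
        = ω ((U φ : CrossedProduct φ) * (ι φ f * star (U φ : CrossedProduct φ))) := by
          rw [← mul_assoc, U_mul_ι_mul_star]
      _ = ω (ι φ f * star (U φ : CrossedProduct φ) *
            ((U φ : CrossedProduct φ) * ι φ (complexPhase F (Complex.I * β)))) :=
          hω.apply_mul (isOneParameterGroup_flow φ F) (isEntireExtension_U φ F) _
      _ = ω (ι φ (complexPhase F (Complex.I * β) * f)) := by
          rw [mul_assoc, ← mul_assoc (star _), Unitary.coe_star_mul_self, one_mul, ← map_mul,
            mul_comm]
  rw [hm', hm'] at hU
  simpa only [ContinuousMap.mul_apply, complexPhase_I_mul_apply] using! hU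

end T2Space

end ConformalState

section Homeomorphism

open CrossedProduct

variable {X : Type u} [TopologicalSpace X] [CompactSpace X] [T2Space X] [HasOuterApproxClosed X]
  [MeasurableSpace X] [BorelSpace X] {φ : X ≃ₜ X} {F : C(X, ℝ)} {β : ℝ}

/-- The conformal measure representing the restriction of a KMS state to `C(X)`. -/
def kmsMeasure (ω : kmsStates (flow φ F) β) : conformalMeasures φ F β :=
  ⟨ω.2.exists_conformalMeasure.choose, ω.2.exists_conformalMeasure.choose_spec.1⟩

theorem apply_ι_eq_integral_kmsMeasure (ω : kmsStates (flow φ F) β) (f : C(X, ℂ)) :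
    ω.1 (ι φ f) = ∫ x, f x ∂((kmsMeasure ω).1 : Measure X) :=
  ω.2.exists_conformalMeasure.choose_spec.2 f

theorem kmsMeasure_eq_iff {ω : kmsStates (flow φ F) β} {m : conformalMeasures φ F β} :
    kmsMeasure ω = m ↔ ∀ f, ω.1 (ι φ f) = ∫ x, f x ∂(m.1 : Measure X) := by
  refine ⟨fun h => h ▸ apply_ι_eq_integral_kmsMeasure ω, fun h => ?_⟩
  have hm : ((kmsMeasure ω).1 : Measure X) = (m.1 : Measure X) :=
    integralFunctional_injective <| DFunLike.ext _ _ fun f =>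
      (apply_ι_eq_integral_kmsMeasure ω f).symm.trans (h f)
  exact Subtype.ext (Subtype.ext hm)

theorem kmsMeasure_convexCombination {ω₁ ω₂ ω₃ : kmsStates (flow φ F) β} {s t : ℝ}
    (hs : 0 ≤ s) (ht : 0 ≤ t) (h : ω₃.1 = s • ω₁.1 + t • ω₂.1) :
    ((kmsMeasure ω₃).1 : Measure X) = ENNReal.ofReal s • ((kmsMeasure ω₁).1 : Measure X) +
      ENNReal.ofReal t • ((kmsMeasure ω₂).1 : Measure X) := by
  have hfinite (r : ℝ) (m : ProbabilityMeasure X) :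
      IsFiniteMeasure (ENNReal.ofReal r • (m : Measure X)) :=
    Measure.smul_finite _ ENNReal.ofReal_ne_top
  have := hfinite s
  have := hfinite t
  refine integralFunctional_injective (DFunLike.ext _ _ fun f => ?_)
  rw [integralFunctional_apply, integralFunctional_apply,
    integral_add_measure (integrable_continuousMap _ f) (integrable_continuousMap _ f),
    integral_smul_measure, integral_smul_measure, ENNReal.toReal_ofReal hs,
    ENNReal.toReal_ofReal ht]
  simp only [← apply_ι_eq_integral_kmsMeasure, h]
  rfl

theorem continuous_kmsMeasure :
    Continuous (kmsMeasure : kmsStates (flow φ F) β → conformalMeasures φ F β) := by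
  refine continuous_induced_rng.2 <| continuous_iff_continuousAt.2 fun ω =>
    (ProbabilityMeasure.tendsto_iff_forall_integral_rclike_tendsto ℂ).2 fun f => ?_
  have hf (ω : kmsStates (flow φ F) β) :
      ∫ x, f x ∂((kmsMeasure ω).1 : Measure X) = ω.1 (ι φ f.toContinuousMap) :=
    (apply_ι_eq_integral_kmsMeasure ω f.toContinuousMap).symm
  simp only [Function.comp_apply, hf]
  exact ((WeakDual.eval_continuous _).comp continuous_subtype_val).tendsto ω

/-- The correspondence `ω ↦ m_ω` between KMS states and conformal measures. -/
def kmsStatesHomeo (hφ : IsFreeHomeo φ) (F : C(X, ℝ)) (β : ℝ) :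
    kmsStates (flow φ F) β ≃ₜ conformalMeasures φ F β where
  toFun := kmsMeasure
  invFun m := ⟨stateOfMeasure φ m.1, isKMSState_stateOfMeasure m.2⟩
  left_inv ω := Subtype.ext (ω.2.eq_stateOfMeasure hφ (apply_ι_eq_integral_kmsMeasure ω)).symm
  right_inv m := kmsMeasure_eq_iff.2 (stateOfMeasure_ι m.1)
  continuous_toFun := continuous_kmsMeasure
  continuous_invFun := (continuous_stateOfMeasure.comp continuous_subtype_val).subtype_mk _

end Homeomorphism

end KMSCrossed

end

theorem corollary3p9_general {X : Type*} [TopologicalSpace X] [CompactSpace X] [T2Space X]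
    [HasOuterApproxClosed X] [MeasurableSpace X] [BorelSpace X] (φ : X ≃ₜ X) (hφ : IsFreeHomeo φ)
    (F : C(X, ℝ)) (β : ℝ) :
    Convex ℝ (kmsStates (CrossedProduct.flow φ F) β) ∧
    ∃ Φ : kmsStates (CrossedProduct.flow φ F) β ≃ₜ conformalMeasures φ F β,
      (∀ (ω : kmsStates (CrossedProduct.flow φ F) β) (f : C(X, ℂ)),
        ω.1 (CrossedProduct.ι φ f) = ∫ x, f x ∂((Φ ω).1 : Measure X)) ∧
      (∀ (ω₁ ω₂ ω₃ : kmsStates (CrossedProduct.flow φ F) β) (s t : ℝ), 0 ≤ s → 0 ≤ t → s + t = 1 →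
        ω₃.1 = s • ω₁.1 + t • ω₂.1 →
        ((Φ ω₃).1 : Measure X) =
          ENNReal.ofReal s • ((Φ ω₁).1 : Measure X) +
            ENNReal.ofReal t • ((Φ ω₂).1 : Measure X)) ∧
      (∀ (m : conformalMeasures φ F β) (a : CrossedProduct φ),
        (Φ.symm m).1 a = ∫ x, CrossedProduct.E φ a x ∂(m.1 : Measure X)) :=
  ⟨convex_kmsStates (CrossedProduct.isOneParameterGroup_flow φ F) β, kmsStatesHomeo hφ F β,
    apply_ι_eq_integral_kmsMeasure,
    fun _ _ _ _ _ hs ht _ h => kmsMeasure_convexCombination hs ht h, fun _ _ => rfl⟩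

theorem corollary3p9 {X : Type*} [MetricSpace X] [CompactSpace X] [MeasurableSpace X]
    [BorelSpace X] [Infinite X] (φ : X ≃ₜ X) (hφ : IsMinimalHomeo φ) (F : C(X, ℝ))
    (β : ℝ) (hβ : β ≠ 0) :
    Convex ℝ (kmsStates (CrossedProduct.flow φ F) β) ∧
    ∃ Φ : kmsStates (CrossedProduct.flow φ F) β ≃ₜ conformalMeasures φ F β,
      (∀ (ω : kmsStates (CrossedProduct.flow φ F) β) (f : C(X, ℂ)),
        ω.1 (CrossedProduct.ι φ f) = ∫ x, f x ∂((Φ ω).1 : Measure X)) ∧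
      (∀ (ω₁ ω₂ ω₃ : kmsStates (CrossedProduct.flow φ F) β) (s t : ℝ), 0 ≤ s → 0 ≤ t → s + t = 1 →
        ω₃.1 = s • ω₁.1 + t • ω₂.1 →
        ((Φ ω₃).1 : Measure X) =
          ENNReal.ofReal s • ((Φ ω₁).1 : Measure X) +
            ENNReal.ofReal t • ((Φ ω₂).1 : Measure X)) ∧
      (∀ (m : conformalMeasures φ F β) (a : CrossedProduct φ),
        (Φ.symm m).1 a = ∫ x, CrossedProduct.E φ a x ∂(m.1 : Measure X)) :=
  corollary3p9_general φ hφ.isFreeHomeo F β
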